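/- Let $2\le n\le m$. Let $M$ be a closed (compact, without boundary), connected, oriented, smooth Riemannian $n$-manifold, let $N$ be a smooth Riemannian $m$-manifold, and let $\omega$ be a non-vanishing $n$-calibration on $N$, that is, a smooth closed differential $n$-form with $0<\|\omega_p\|_{\mathrm{comass}}\le\sup_{q\in N}\|\omega_q\|_{\mathrm{comass}}=1$ for every $p\in N$, where $\|\omega_p\|_{\mathrm{comass}}=\sup\{\omega_p(v_1,\dots,v_n): v_i\in T_pN,\ |v_1|=\dots=|v_n|=1\}$. Let $K\ge 1$ and let $F\colon M\to N$ be a $K$-quasiregular $\omega$-curve, that is, a continuous map in the Sobolev space $W^{1,n}_{\mathrm{loc}}(M,N)$ whose weak differential $DF$ satisfies $$(\|\omega\|_{\mathrm{comass}}\circ F)\,\|DF\|^n\le K\,(\star F^*\omega)\quad\text{almost everywhere in } M,$$ where $\|DF\|$ is the pointwise operator norm and $\star$ is the Hodge star of $M$. If $F(M)\subset U$ for an open set $U\subset N$ for which the de Rham class $[\omega|_U]\in H^n(U)$ is zero, then $F$ is constant. -/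

import Mathlib

open Bundle Manifold MeasureTheory Set Filter Topology
open scoped ContDiff

noncomputable section

namespace QRCurve

/-- The model space `ℝᵏ` with its Euclidean norm. -/
abbrev Eucl (k : ℕ) : Type := EuclideanSpace ℝ (Fin k)

/-! ### Differential forms and de Rham cohomology of open subsets -/

section Forms

variable {m : ℕ} {N : Type*} [TopologicalSpace N] [ChartedSpace (Eucl m) N]

/-- A (not necessarily continuous) differential `k`-form on the `m`-manifold `N`: an alternating
`k`-linear form on every tangent space. -/
abbrev DForm (m : ℕ) (N : Type*) [TopologicalSpace N] [ChartedSpace (Eucl m) N] (k : ℕ) : Type _ :=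
  ∀ p : N, TangentSpace (𝓡 m) p [⋀^Fin k]→L[ℝ] ℝ

/-- The coordinate representation `(e⁻¹)^* α` of a form in a chart `e`. It is meaningful on
`e.target`. -/
def formInChart {k : ℕ} (e : OpenPartialHomeomorph N (Eucl m)) (α : DForm m N k) (y : Eucl m) :
    Eucl m [⋀^Fin k]→L[ℝ] ℝ :=
  ContinuousAlternatingMap.compContinuousLinearMap (α (e.symm y))
    (mfderiv (𝓡 m) (𝓡 m) e.symm y)

/-- `α` is `C^∞` on the open set `U`: its representations in all smooth charts are. -/
def IsSmoothFormOn {k : ℕ} (U : Set N) (α : DForm m N k) : Prop :=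
  ∀ e ∈ IsManifold.maximalAtlas (𝓡 m) ∞ N,
    ContDiffOn ℝ ∞ (formInChart e α) (e.target ∩ e.symm ⁻¹' U)

/-- `dτ = η` on the open set `U`, where `d` is the exterior derivative, computed in charts. -/
def HasExtDerivOn {k : ℕ} (U : Set N) (τ : DForm m N k) (η : DForm m N (k + 1)) : Prop :=
  ∀ e ∈ IsManifold.maximalAtlas (𝓡 m) ∞ N, ∀ y ∈ e.target ∩ e.symm ⁻¹' U,
    extDeriv (formInChart e τ) y = formInChart e η y

lemma formInChart_add {k : ℕ} (e : OpenPartialHomeomorph N (Eucl m)) (α η : DForm m N k) :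
    formInChart e (α + η) = formInChart e α + formInChart e η := by
  ext y v; rfl

lemma formInChart_smul {k : ℕ} (e : OpenPartialHomeomorph N (Eucl m)) (c : ℝ) (α : DForm m N k) :
    formInChart e (c • α) = c • formInChart e α := by
  ext y v; rfl

lemma formInChart_zero {k : ℕ} (e : OpenPartialHomeomorph N (Eucl m)) :
    formInChart e (0 : DForm m N k) = 0 := by
  ext y v; rfl

lemma IsSmoothFormOn.zero {k : ℕ} (U : Set N) : IsSmoothFormOn U (0 : DForm m N k) := by
  intro e _
  rw [formInChart_zero]
  exact contDiffOn_const

lemma IsSmoothFormOn.add {k : ℕ} {U : Set N} {α η : DForm m N k} (h : IsSmoothFormOn U α)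
    (h' : IsSmoothFormOn U η) : IsSmoothFormOn U (α + η) := by
  intro e he
  rw [formInChart_add]
  exact (h e he).add (h' e he)

lemma IsSmoothFormOn.smul {k : ℕ} {U : Set N} (c : ℝ) {α : DForm m N k}
    (h : IsSmoothFormOn U α) : IsSmoothFormOn U (c • α) := by
  intro e he
  rw [formInChart_smul]
  exact contDiffOn_const.smul (h e he)

lemma IsSmoothFormOn.mono {k : ℕ} {U V : Set N} {α : DForm m N k}
    (h : IsSmoothFormOn V α) (hUV : U ⊆ V) : IsSmoothFormOn U α :=
  fun e he ↦ (h e he).mono fun _ hy ↦ ⟨hy.1, hUV hy.2⟩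

lemma IsSmoothFormOn.differentiableAt {k : ℕ} {U : Set N} (hU : IsOpen U) {α : DForm m N k}
    (h : IsSmoothFormOn U α) {e : OpenPartialHomeomorph N (Eucl m)}
    (he : e ∈ IsManifold.maximalAtlas (𝓡 m) ∞ N) {y : Eucl m}
    (hy : y ∈ e.target ∩ e.symm ⁻¹' U) : DifferentiableAt ℝ (formInChart e α) y :=
  ((h e he).differentiableOn (by simp)).differentiableAt
    ((e.isOpen_inter_preimage_symm hU).mem_nhds hy)

lemma HasExtDerivOn.zero {k : ℕ} (U : Set N) :
    HasExtDerivOn U (0 : DForm m N k) (0 : DForm m N (k + 1)) := by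
  intro e _ y _
  rw [formInChart_zero, formInChart_zero]
  have h := extDeriv_smul (x := y) (0 : ℝ) (0 : Eucl m → Eucl m [⋀^Fin k]→L[ℝ] ℝ)
  simpa using h

lemma HasExtDerivOn.add {k : ℕ} {U : Set N} (hU : IsOpen U) {τ τ' : DForm m N k}
    {η η' : DForm m N (k + 1)} (hτ : IsSmoothFormOn U τ) (hτ' : IsSmoothFormOn U τ')
    (h : HasExtDerivOn U τ η) (h' : HasExtDerivOn U τ' η') :
    HasExtDerivOn U (τ + τ') (η + η') := by
  intro e he y hy
  rw [formInChart_add, formInChart_add,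
    extDeriv_add (hτ.differentiableAt hU he hy) (hτ'.differentiableAt hU he hy), h e he y hy,
    h' e he y hy]
  rfl

lemma HasExtDerivOn.smul {k : ℕ} {U : Set N} (c : ℝ) {τ : DForm m N k}
    {η : DForm m N (k + 1)} (h : HasExtDerivOn U τ η) : HasExtDerivOn U (c • τ) (c • η) := by
  intro e he y hy
  rw [formInChart_smul, formInChart_smul, extDeriv_smul, h e he y hy]
  rfl

lemma HasExtDerivOn.mono {k : ℕ} {U V : Set N} {τ : DForm m N k}
    {η : DForm m N (k + 1)} (h : HasExtDerivOn V τ η) (hUV : U ⊆ V) : HasExtDerivOn U τ η :=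
  fun e he y hy ↦ h e he y ⟨hy.1, hUV hy.2⟩

/-- The smooth closed `k`-forms on the open set `U`. A form on `U` is represented by any form on
`N` with the given values on `U`; the values outside `U` play no role. -/
def closedForms {U : Set N} (hU : IsOpen U) (k : ℕ) : Submodule ℝ (DForm m N k) where
  carrier := {α | IsSmoothFormOn U α ∧ HasExtDerivOn U α 0}
  zero_mem' := ⟨.zero U, .zero U⟩
  add_mem' := fun h h' ↦ ⟨h.1.add h'.1, by simpa using h.2.add hU h.1 h'.1 h'.2⟩
  smul_mem' := fun c _ h ↦ ⟨h.1.smul c, by simpa using h.2.smul c⟩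

/-- The exact `k`-forms on the open set `U`: the forms `dτ` with `τ` a smooth `(k - 1)`-form on
`U` and, in degree zero, only the zero form on `U`. In particular every form that vanishes on `U`
is exact on `U`. -/
def exactForms {U : Set N} (hU : IsOpen U) : ∀ k : ℕ, Submodule ℝ (DForm m N k)
  | 0 =>
    { carrier := {α | ∀ p ∈ U, α p = 0}
      zero_mem' := fun _ _ ↦ rfl
      add_mem' := fun {a b} h h' p hp ↦ by
        change a p + b p = 0
        rw [h p hp, h' p hp, add_zero]
      smul_mem' := fun c a h p hp ↦ by
        change c • a p = 0
        rw [h p hp, smul_zero] }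
  | k + 1 =>
    { carrier := {α | ∃ τ : DForm m N k, IsSmoothFormOn U τ ∧ HasExtDerivOn U τ α}
      zero_mem' := ⟨0, .zero U, .zero U⟩
      add_mem' := by
        rintro a b ⟨τ, hτ, h⟩ ⟨τ', hτ', h'⟩
        exact ⟨τ + τ', hτ.add hτ', h.add hU hτ hτ' h'⟩
      smul_mem' := by
        rintro c a ⟨τ, hτ, h⟩
        exact ⟨c • τ, hτ.smul c, h.smul c⟩ }

instance {U : Set N} (hU : IsOpen U) (k : ℕ) : AddCommGroup (closedForms (m := m) hU k) :=
  Submodule.addCommGroup _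

/-- The de Rham cohomology `H^k(U)` of an open subset `U` of `N`: closed forms on `U` modulo exact
forms on `U`. Forms that agree on `U` have the same class. -/
abbrev DeRhamCohomology {U : Set N} (hU : IsOpen U) (k : ℕ) : Type _ :=
  closedForms (m := m) hU k ⧸ (exactForms (m := m) hU k).comap (closedForms (m := m) hU k).subtype

/-- The class `[α|_U] ∈ H^k(U)` of a smooth closed form `α` on `N`. -/
def restrictClass {k : ℕ} {α : DForm m N k} (hs : IsSmoothFormOn univ α)
    (hc : HasExtDerivOn univ α 0) {U : Set N} (hU : IsOpen U) : DeRhamCohomology (m := m) hU k :=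
  Submodule.Quotient.mk ⟨α, hs.mono (subset_univ U), hc.mono (subset_univ U)⟩

end Forms

/-! ### Calibrations -/

section Calibration

variable {m : ℕ} {N : Type*} [TopologicalSpace N] [ChartedSpace (Eucl m) N]
  [RiemannianBundle (fun p : N ↦ TangentSpace (𝓡 m) p)]

/-- The pointwise comass norm
`‖α_p‖ = sup {α_p(v₁, …, vₖ) : |v₁| = ⋯ = |vₖ| = 1}`. -/
def comass {k : ℕ} (α : DForm m N k) (p : N) : ℝ :=
  sSup {r : ℝ | ∃ v : Fin k → TangentSpace (𝓡 m) p, (∀ i, ‖v i‖ = 1) ∧ r = α p v}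

/-- `α` is a non-vanishing calibration on `N`: a smooth closed form with
`0 < ‖α_p‖ ≤ sup_p ‖α_p‖ = 1`. -/
structure IsNonvanishingCalibration {k : ℕ} (α : DForm m N k) : Prop where
  smooth : IsSmoothFormOn univ α
  closed : HasExtDerivOn univ α 0
  comass_pos : ∀ p, 0 < comass α p
  sup_comass : IsLUB (range (comass α)) 1

end Calibration

/-! ### Orientations and the Hodge star on top degree forms -/

section Orientation

variable {n : ℕ}

/-- A choice of orientations of the tangent spaces of the `n`-manifold `M` is an orientation of
`M` if around every point there is a smooth chart whose coordinate frame `∂₁, …, ∂ₙ` is everywhere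
positively oriented. -/
def IsManifoldOrientation {M : Type*} [TopologicalSpace M] [ChartedSpace (Eucl n) M]
    (o : ∀ x : M, Orientation ℝ (TangentSpace (𝓡 n) x) (Fin n)) : Prop :=
  ∀ x₀ : M, ∃ e ∈ IsManifold.maximalAtlas (𝓡 n) ∞ M, x₀ ∈ e.source ∧ ∀ x ∈ e.source,
    ∃ b : Module.Basis (Fin n) ℝ (TangentSpace (𝓡 n) x), b.orientation = o x ∧
      ∀ i, b i = mfderiv (𝓡 n) (𝓡 n) e.symm (e x) (EuclideanSpace.single i (1 : ℝ))

/-- The Hodge star of a top degree form on an oriented Euclidean space `V`: the inner product of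
`η` with the volume form, that is, the unique number `⋆η` with `η = (⋆η) vol`; see
`eq_hodgeStar_smul_volumeForm` and `hodgeStar_eq`. -/
def hodgeStar {V : Type*} [NormedAddCommGroup V] [InnerProductSpace ℝ V] [FiniteDimensional ℝ V]
    [hV : Fact (Module.finrank ℝ V = n)] (o : Orientation ℝ V (Fin n))
    (η : V [⋀^Fin n]→L[ℝ] ℝ) : ℝ :=
  η ((stdOrthonormalBasis ℝ V).reindex (finCongr hV.out)) *
    o.volumeForm ((stdOrthonormalBasis ℝ V).reindex (finCongr hV.out))

lemma eq_hodgeStar_smul_volumeForm {V : Type*} [NormedAddCommGroup V] [InnerProductSpace ℝ V]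
    [FiniteDimensional ℝ V] [hV : Fact (Module.finrank ℝ V = n)] (o : Orientation ℝ V (Fin n))
    (η : V [⋀^Fin n]→L[ℝ] ℝ) : η.toAlternatingMap = hodgeStar o η • o.volumeForm := by
  set b : OrthonormalBasis (Fin n) ℝ V := (stdOrthonormalBasis ℝ V).reindex (finCongr hV.out)
    with hb
  have h1 : |o.volumeForm b| = 1 := o.abs_volumeForm_apply_of_orthonormal b
  have h2 : o.volumeForm b * o.volumeForm b = 1 := by
    rw [← abs_mul_abs_self, h1, one_mul]
  have h3 : η.toAlternatingMap = η b • b.toBasis.det := by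
    simpa using η.toAlternatingMap.eq_smul_basis_det b.toBasis
  have h4 : o.volumeForm = o.volumeForm b • b.toBasis.det := by
    simpa using o.volumeForm.eq_smul_basis_det b.toBasis
  calc η.toAlternatingMap = η b • b.toBasis.det := h3
    _ = (η b * (o.volumeForm b * o.volumeForm b)) • b.toBasis.det := by rw [h2, mul_one]
    _ = (η b * o.volumeForm b) • (o.volumeForm b • b.toBasis.det) := by
      rw [smul_smul, mul_assoc]
    _ = (η b * o.volumeForm b) • o.volumeForm := by rw [← h4]
    _ = hodgeStar o η • o.volumeForm := rfl

/-- `⋆η` is the value of `η` on any positively oriented orthonormal basis. -/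
lemma hodgeStar_eq {V : Type*} [NormedAddCommGroup V] [InnerProductSpace ℝ V]
    [FiniteDimensional ℝ V] [hV : Fact (Module.finrank ℝ V = n)] (o : Orientation ℝ V (Fin n))
    (η : V [⋀^Fin n]→L[ℝ] ℝ) (b : OrthonormalBasis (Fin n) ℝ V) (hb : b.toBasis.orientation = o) :
    hodgeStar o η = η b := by
  have h := congrArg (fun f : V [⋀^Fin n]→ₗ[ℝ] ℝ ↦ f b) (eq_hodgeStar_smul_volumeForm o η)
  have h1 : o.volumeForm b = 1 := by
    rw [o.volumeForm_robust b hb]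
    exact b.toBasis.det_self
  simpa [h1] using h.symm

instance finiteDimensional_tangentSpace {M : Type*} [TopologicalSpace M] [ChartedSpace (Eucl n) M]
    (x : M) : FiniteDimensional ℝ (TangentSpace (𝓡 n) x) :=
  inferInstanceAs (FiniteDimensional ℝ (Eucl n))

instance fact_finrank_tangentSpace {M : Type*} [TopologicalSpace M] [ChartedSpace (Eucl n) M]
    (x : M) : Fact (Module.finrank ℝ (TangentSpace (𝓡 n) x) = n) :=
  ⟨finrank_euclideanSpace_fin⟩

end Orientation

/-! ### Sobolev maps between manifolds and quasiregular curves -/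

section Sobolev

/-- The function `G` is a weak derivative of `u` in the open set `O ⊆ ℝⁿ`:
`∫ (∂_v φ) u = - ∫ φ G(v)` for all test functions `φ ∈ C_c^∞(O)` and all vectors `v`. -/
def IsWeakDerivOn {n m : ℕ} (u : Eucl n → Eucl m) (G : Eucl n → Eucl n →L[ℝ] Eucl m)
    (O : Set (Eucl n)) : Prop :=
  ∀ φ : Eucl n → ℝ, ContDiff ℝ ∞ φ → HasCompactSupport φ → tsupport φ ⊆ O → ∀ v : Eucl n,
    ∫ y, fderiv ℝ φ y v • u y = - ∫ y, φ y • G y v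

variable {n m : ℕ} {M N : Type*} [TopologicalSpace M] [ChartedSpace (Eucl n) M]
  [TopologicalSpace N] [ChartedSpace (Eucl m) N]

/-- The coordinate representation of a field of linear maps `DF x : T_x M → T_{F x} N` in charts
`e` of `M` and `e'` of `N`. -/
def differentialInCharts {F : M → N}
    (DF : ∀ x : M, TangentSpace (𝓡 n) x →L[ℝ] TangentSpace (𝓡 m) (F x))
    (e : OpenPartialHomeomorph M (Eucl n)) (e' : OpenPartialHomeomorph N (Eucl m))
    (y : Eucl n) : Eucl n →L[ℝ] Eucl m :=
  (mfderiv (𝓡 m) (𝓡 m) e' (F (e.symm y))).comp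
    ((DF (e.symm y)).comp (mfderiv (𝓡 n) (𝓡 n) e.symm y))

/-- The continuous map `F : M → N` belongs to `W^{1,p}_loc(M, N)` and has weak differential `DF`:
for all smooth charts `e` of `M` and `e'` of `N`, the coordinate representation
`e' ∘ F ∘ e⁻¹` has, on the open set where it is defined, the coordinate
representation of `DF` as weak derivative, and the latter is locally `p`-integrable. -/
structure IsSobolevWithDifferential (p : ℕ) (F : M → N)
    (DF : ∀ x : M, TangentSpace (𝓡 n) x →L[ℝ] TangentSpace (𝓡 m) (F x)) : Prop where
  continuous : Continuous F
  memLp_loc : ∀ e ∈ IsManifold.maximalAtlas (𝓡 n) ∞ M, ∀ e' ∈ IsManifold.maximalAtlas (𝓡 m) ∞ N,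
    ∀ C : Set (Eucl n), IsCompact C → C ⊆ e.target ∩ e.symm ⁻¹' (F ⁻¹' e'.source) →
      MemLp (differentialInCharts DF e e') p (volume.restrict C)
  weakDeriv : ∀ e ∈ IsManifold.maximalAtlas (𝓡 n) ∞ M, ∀ e' ∈ IsManifold.maximalAtlas (𝓡 m) ∞ N,
    IsWeakDerivOn (fun y ↦ e' (F (e.symm y))) (differentialInCharts DF e e')
      (e.target ∩ e.symm ⁻¹' (F ⁻¹' e'.source))

/-- The property `P` holds almost everywhere in the manifold `M`, i.e. outside a set that is
Lebesgue null in every smooth chart. -/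
def AlmostEverywhere (n : ℕ) {M : Type*} [TopologicalSpace M] [ChartedSpace (Eucl n) M]
    (P : M → Prop) : Prop :=
  ∀ e ∈ IsManifold.maximalAtlas (𝓡 n) ∞ M,
    ∀ᵐ y ∂(volume.restrict e.target : Measure (Eucl n)), P (e.symm y)

variable [RiemannianBundle (fun x : M ↦ TangentSpace (𝓡 n) x)]
  [RiemannianBundle (fun p : N ↦ TangentSpace (𝓡 m) p)]

/-- `F : M → N` is a `K`-quasiregular `α`-curve, where `M` is oriented by `o`: it is a continuous
map in `W^{1,n}_loc(M, N)` whose weak differential `DF` (which is unique up to null sets) satisfies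
`(‖α‖ ∘ F) ‖DF‖ⁿ ≤ K (⋆ F^*α)` almost everywhere in `M`, with the operator norm `‖DF‖`. -/
def IsQuasiregularCurve (o : ∀ x : M, Orientation ℝ (TangentSpace (𝓡 n) x) (Fin n)) (K : ℝ)
    (α : DForm m N n) (F : M → N) : Prop :=
  ∃ DF : ∀ x : M, TangentSpace (𝓡 n) x →L[ℝ] TangentSpace (𝓡 m) (F x),
    IsSobolevWithDifferential n F DF ∧
    AlmostEverywhere n fun x : M ↦
      comass α (F x) * ‖DF x‖ ^ n ≤
        K * hodgeStar (o x) ((α (F x)).compContinuousLinearMap (DF x))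

end Sobolev

end QRCurve

end

open Bundle Manifold MeasureTheory Set Filter Topology
open scoped ContDiff

noncomputable section

namespace QRCurve

/-! ### Evaluation of alternating forms along linear maps -/

section Alternating

variable {V W X : Type*} [NormedAddCommGroup V] [NormedSpace ℝ V] [NormedAddCommGroup W]
  [NormedSpace ℝ W] [NormedAddCommGroup X] [NormedSpace ℝ X]

/-! On `U` the calibration has a primitive, `ω = dτ`, so `F^*ω = d(F^*τ)` weakly and Stokes' theorem
on the closed manifold `M` gives `∫_M F^*ω = 0`. The quasiregularity inequality makes `⋆F^*ω`
nonnegative almost everywhere, hence it vanishes almost everywhere. The same inequality and the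
positivity of the comass then force `DF = 0` almost everywhere. A continuous map with zero weak
derivative is locally constant, and `M` is connected.

The analytic core is Stokes' theorem for a map that is only continuous and `W^{1,n}`. In charts the
map is mollified (`exists_smooth_approx`), the smooth identity `integral_mul_extDeriv_pullback` is
applied to the mollifications, and the limit is taken. The pullbacks of forms of degree at most `n`
are bounded by multiples of `1 + ‖Dv_j‖ⁿ`, and Jensen's inequality bounds `‖Dv_j‖ⁿ` by
mollifications of `‖G‖ⁿ`. These have constant integral, so a dominated convergence theorem with
varying bounds (`tendsto_integral_of_tendsto_dominating`) applies. The result is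
`integral_mul_extDeriv`.

The global statement is `sum_integral_pullForm_eq_zero`. For a partition of unity `φ_i` subordinate
to positive charts, `∫ φ_i F^*ω = -∫ dφ_i ∧ F^*τ`. Inserting `1 = ∑_j φ_j` splits the right side
into terms `φ_j dφ_i ∧ F^*τ`, each of which may be integrated in chart `j`
(`integral_formInChart_eq`), where the sum over `i` vanishes because `∑_i dφ_i = 0`. -/

/-- The wedge product `η ∧ σ` of a linear form `η` and an alternating `k`-form `σ`. -/
def oneWedge {k : ℕ} (η : V →L[ℝ] ℝ) (σ : V [⋀^Fin k]→L[ℝ] ℝ) : V [⋀^Fin (k + 1)]→L[ℝ] ℝ :=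
  .alternatizeUncurryFin (η.smulRight σ)

lemma oneWedge_apply {k : ℕ} (η : V →L[ℝ] ℝ) (σ : V [⋀^Fin k]→L[ℝ] ℝ) (v : Fin (k + 1) → V) :
    oneWedge η σ v = ∑ i, (-1) ^ i.val * (η (v i) * σ (i.removeNth v)) := by
  simp [oneWedge, ContinuousAlternatingMap.alternatizeUncurryFin_apply]

lemma oneWedge_comp {k : ℕ} (η : V →L[ℝ] ℝ) (σ : V [⋀^Fin k]→L[ℝ] ℝ) (L : W →L[ℝ] V) :
    oneWedge (η.comp L) (σ.compContinuousLinearMap L) =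
      (oneWedge η σ).compContinuousLinearMap L := by
  ext v
  simp only [oneWedge_apply, ContinuousAlternatingMap.compContinuousLinearMap_apply,
    ContinuousLinearMap.comp_apply, Function.comp_apply]
  rfl

lemma contDiff_uncurry_alternating {ι : Type*} [Fintype ι] :
    ContDiff ℝ ∞ fun p : (V [⋀^ι]→L[ℝ] ℝ) × (ι → V) ↦ p.1 p.2 := by
  have h := (ContinuousAlternatingMap.toContinuousMultilinearMapCLM ℝ :
    (V [⋀^ι]→L[ℝ] ℝ) →L[ℝ] _).analyticOnNhd_uncurry_of_multilinear (s := univ)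
  exact h.contDiff

lemma contDiff_pullback_apply {ι : Type*} [Fintype ι] {T : X → V [⋀^ι]→L[ℝ] ℝ}
    {L : X → W →L[ℝ] V} (hT : ContDiff ℝ ∞ T) (hL : ContDiff ℝ ∞ L) (w : ι → W) :
    ContDiff ℝ ∞ fun x ↦ T x (fun i ↦ L x (w i)) :=
  contDiff_uncurry_alternating.comp
    (hT.prodMk (contDiff_pi.2 fun _ ↦ hL.clm_apply contDiff_const))

lemma continuous_apply_forms {ι : Type*} [Fintype ι] (w : ι → W) :
    Continuous fun p : (V [⋀^ι]→L[ℝ] ℝ) × (W →L[ℝ] V) ↦ p.1 (fun i ↦ p.2 (w i)) :=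
  contDiff_uncurry_alternating.continuous.comp
    (continuous_fst.prodMk (continuous_pi fun _ ↦ continuous_snd.clm_apply continuous_const))

lemma abs_form_apply_le {k : ℕ} (A : V [⋀^Fin k]→L[ℝ] ℝ) (L : W →L[ℝ] V) {w : Fin k → W}
    (hw : ∀ i, ‖w i‖ ≤ 1) : |A fun i ↦ L (w i)| ≤ ‖A‖ * ‖L‖ ^ k := by
  have h := A.le_opNorm_mul_prod_of_le (m := fun i ↦ L (w i)) (b := fun _ ↦ ‖L‖)
    fun i ↦ (L.le_opNorm _).trans (mul_le_of_le_one_right (norm_nonneg _) (hw i))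
  simpa using h

/-- Stokes' theorem for the pullback of a form by a smooth map, tested against a compactly
supported function. -/
lemma integral_mul_extDeriv_pullback {k : ℕ} {E : Type*} [NormedAddCommGroup E] [NormedSpace ℝ E]
    [FiniteDimensional ℝ E] [MeasurableSpace E] [BorelSpace E] (μ : Measure E)
    [μ.IsAddHaarMeasure]
    {T : V → V [⋀^Fin k]→L[ℝ] ℝ} (hT : ContDiff ℝ ∞ T) {f : E → V} (hf : ContDiff ℝ ∞ f)
    {ψ : E → ℝ} (hψ : ContDiff ℝ ∞ ψ) (hψc : HasCompactSupport ψ) (w : Fin (k + 1) → E) :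
    ∫ y, ψ y * extDeriv T (f y) (fun i ↦ fderiv ℝ f y (w i)) ∂μ =
      -∫ y, oneWedge (fderiv ℝ ψ y) ((T (f y)).compContinuousLinearMap (fderiv ℝ f y)) w ∂μ := by
  have hf' : ContDiff ℝ ∞ (fderiv ℝ f) := hf.fderiv_right (by simp)
  set S : E → E [⋀^Fin k]→L[ℝ] ℝ :=
    fun y ↦ (T (f y)).compContinuousLinearMap (fderiv ℝ f y) with hS
  have hSw : ∀ w : Fin k → E, ContDiff ℝ ∞ fun y ↦ S y w := fun w ↦
    contDiff_pullback_apply (hT.comp hf) hf' w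
  have hSd : Differentiable ℝ S := fun y ↦
    DifferentiableAt.continuousAlternatingMapCompContinuousLinearMap
      (((hT.differentiable (by simp)).comp (hf.differentiable (by simp))) y)
      ((hf'.differentiable (by simp)) y)
  -- Exterior differentiation commutes with pullback by `f`. In the constant directions `w i` the
  -- exterior derivative is an alternating sum of directional derivatives of coefficients of `S`, so
  -- Stokes reduces to one integration by parts per summand (`key`).
  have hd : ∀ y, extDeriv T (f y) (fun i ↦ fderiv ℝ f y (w i)) =
      ∑ i : Fin (k + 1), (-1) ^ i.val * fderiv ℝ (fun y ↦ S y (i.removeNth w)) y (w i) := by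
    intro y
    have h1 := extDeriv_pullback (x := y) (r := ∞) ((hT.differentiable (by simp)) (f y))
      hf.contDiffAt (by rw [minSmoothness_of_isRCLikeNormedField]; exact WithTop.coe_le_coe.2 (le_top (a := (2 : ℕ∞))))
    have h2 := congrArg (fun A : E [⋀^Fin (k + 1)]→L[ℝ] ℝ ↦ A w) h1
    rw [ContinuousAlternatingMap.compContinuousLinearMap_apply] at h2
    refine h2.symm.trans ?_
    have h3 := extDeriv_apply (hSd y) w
    simpa using h3
  have hi : ∀ {g : E → ℝ}, Continuous g → (tsupport g ⊆ tsupport ψ) → Integrable g μ :=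
    fun hg hs ↦ hg.integrable_of_hasCompactSupport
      (hψc.of_isClosed_subset (isClosed_tsupport _) hs)
  have hdc : ∀ i : Fin (k + 1),
      Continuous fun y ↦ fderiv ℝ (fun y ↦ S y (i.removeNth w)) y (w i) := fun i ↦
    ((hSw _).continuous_fderiv (by simp)).clm_apply continuous_const
  have hdψ : ∀ i : Fin (k + 1), Continuous fun y ↦ fderiv ℝ ψ y (w i) := fun i ↦
    (hψ.continuous_fderiv (by simp)).clm_apply continuous_const
  have hs1 : ∀ g : E → ℝ, tsupport (fun y ↦ ψ y * g y) ⊆ tsupport ψ := fun g ↦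
    tsupport_mul_subset_left
  have hs2 : ∀ (g : E → ℝ) (v : E), tsupport (fun y ↦ fderiv ℝ ψ y v * g y) ⊆ tsupport ψ :=
    fun g v ↦ tsupport_mul_subset_left.trans (tsupport_fderiv_apply_subset ℝ v)
  have key : ∀ i : Fin (k + 1),
      ∫ y, ψ y * fderiv ℝ (fun y ↦ S y (i.removeNth w)) y (w i) ∂μ =
        -∫ y, fderiv ℝ ψ y (w i) * S y (i.removeNth w) ∂μ := fun i ↦
    integral_mul_fderiv_eq_neg_fderiv_mul_of_integrable
      (hi ((hdψ i).mul (hSw _).continuous) (hs2 _ _))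
      (hi (hψ.continuous.mul (hdc i)) (hs1 _))
      (hi (hψ.continuous.mul (hSw _).continuous) (hs1 _))
      (fun x _ ↦ (hψ.differentiable (by simp)) x)
      (fun x _ ↦ ((hSw _).differentiable (by simp)) x)
  simp only [hd, oneWedge_apply, Finset.mul_sum]
  rw [integral_finsetSum, integral_finsetSum, ← Finset.sum_neg_distrib]
  · refine Finset.sum_congr rfl fun i _ ↦ ?_
    rw [integral_const_mul, ← mul_neg, ← key i, ← integral_const_mul]
    congr 1; ext y; ring
  · exact fun i _ ↦ (hi ((hdψ i).mul (hSw _).continuous) (hs2 _ _)).const_mul _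
  · intro i _
    refine ((hi (hψ.continuous.mul (hdc i)) (hs1 _)).const_mul ((-1) ^ i.val)).congr
      (Eventually.of_forall fun y ↦ ?_)
    simp only [Pi.mul_apply]
    ring

end Alternating

/-! ### A dominated convergence theorem with converging bounds -/

/-- Truncate `f j` to the interval `[-g', g']`. The truncations converge by ordinary dominated
convergence with bound `g'`. The truncation error is at most `g j - min (g j) g'`, whose integral
tends to zero because `min (g j) g'` is itself dominated by `g'` and `∫ g j` tends to `∫ g'`. -/
lemma tendsto_integral_of_tendsto_dominating {X : Type*} [MeasurableSpace X] {μ : Measure X}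
    {f : ℕ → X → ℝ} {f' : X → ℝ} {g : ℕ → X → ℝ} {g' : X → ℝ}
    (hf : ∀ j, AEStronglyMeasurable (f j) μ) (hg : ∀ j, Integrable (g j) μ) (hg' : Integrable g' μ)
    (hfg : ∀ j, ∀ᵐ x ∂μ, |f j x| ≤ g j x)
    (hff' : ∀ᵐ x ∂μ, Tendsto (fun j ↦ f j x) atTop (𝓝 (f' x)))
    (hgg' : ∀ᵐ x ∂μ, Tendsto (fun j ↦ g j x) atTop (𝓝 (g' x)))
    (hint : Tendsto (fun j ↦ ∫ x, g j x ∂μ) atTop (𝓝 (∫ x, g' x ∂μ))) :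
    Tendsto (fun j ↦ ∫ x, f j x ∂μ) atTop (𝓝 (∫ x, f' x ∂μ)) := by
  have hall := ae_all_iff.2 hfg
  have hg0 : ∀ᵐ x ∂μ, 0 ≤ g' x := by
    filter_upwards [hall, hgg'] with x h1 h2
    exact ge_of_tendsto' h2 fun j ↦ (abs_nonneg _).trans (h1 j)
  have hfg' : ∀ᵐ x ∂μ, |f' x| ≤ g' x := by
    filter_upwards [hall, hff', hgg'] with x h1 h2 h3
    exact le_of_tendsto_of_tendsto' h2.abs h3 h1
  have hmin : Tendsto (fun j ↦ ∫ x, min (g j x) (g' x) ∂μ) atTop (𝓝 (∫ x, g' x ∂μ)) := by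
    refine tendsto_integral_of_dominated_convergence g'
      (fun j ↦ (hg j).1.inf hg'.1) hg' (fun j ↦ ?_) ?_
    · filter_upwards [hall, hg0] with x h1 h2
      rw [Real.norm_of_nonneg (le_min ((abs_nonneg _).trans (h1 j)) h2)]
      exact min_le_right _ _
    · filter_upwards [hgg'] with x h1
      simpa using h1.min (tendsto_const_nhds (x := g' x))
  set c : ℕ → X → ℝ := fun j x ↦ max (-g' x) (min (f j x) (g' x)) with hc
  have hcm : ∀ j, AEStronglyMeasurable (c j) μ := fun j ↦ hg'.1.neg.sup ((hf j).inf hg'.1)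
  have hcb : ∀ j, ∀ᵐ x ∂μ, ‖c j x‖ ≤ g' x := by
    intro j
    filter_upwards [hg0] with x h0
    rw [Real.norm_eq_abs, abs_le]
    exact ⟨le_max_left _ _, max_le (by linarith) (min_le_right _ _)⟩
  have hclip : Tendsto (fun j ↦ ∫ x, c j x ∂μ) atTop (𝓝 (∫ x, f' x ∂μ)) := by
    refine tendsto_integral_of_dominated_convergence g' hcm hg' hcb ?_
    filter_upwards [hff', hfg'] with x h1 h2
    have h3 := (tendsto_const_nhds (x := -g' x)).max (h1.min (tendsto_const_nhds (x := g' x)))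
    rw [abs_le] at h2
    rwa [min_eq_left h2.2, max_eq_right h2.1] at h3
  have hfi : ∀ j, Integrable (f j) μ := fun j ↦ (hg j).mono' (hf j) (hfg j)
  have hci : ∀ j, Integrable (c j) μ := fun j ↦ hg'.mono' (hcm j) (hcb j)
  have hmi : ∀ j, Integrable (fun x ↦ min (g j x) (g' x)) μ := fun j ↦ (hg j).inf hg'
  have hdiff : Tendsto (fun j ↦ ∫ x, f j x ∂μ - ∫ x, c j x ∂μ) atTop (𝓝 0) := by
    refine squeeze_zero_norm (a := fun j ↦ ∫ x, g j x ∂μ - ∫ x, min (g j x) (g' x) ∂μ)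
      (fun j ↦ ?_) (by simpa using hint.sub hmin)
    rw [← integral_sub (hfi j) (hci j), ← integral_sub (hg j) (hmi j)]
    refine norm_integral_le_of_norm_le ((hg j).sub (hmi j)) ?_
    filter_upwards [hfg j, hg0] with x h1 h0
    rw [abs_le] at h1
    rw [Real.norm_eq_abs, abs_le]
    simp only [hc]
    rcases le_total (f j x) (g' x) with h2 | h2 <;> rcases le_total (g j x) (g' x) with h3 | h3 <;>
      rcases le_total (-g' x) (f j x) with h4 | h4 <;>
      simp only [min_eq_left h2, min_eq_right h2, min_eq_left h3, min_eq_right h3,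
        max_eq_left h4, max_eq_right h4, max_eq_right (neg_le_self h0)] <;>
      constructor <;> linarith
  simpa using hdiff.add hclip

/-! ### Mollification of Sobolev maps -/

section Mollification

open ContinuousLinearMap Convolution Metric

variable {n m : ℕ}

/-- The normalised bump is a probability density, so the mollification at `x` is the mean of `G (x -
t)` under a probability measure `ν`. The bound is Jensen's inequality for the convex function `s ↦ s
^ p` on `[0, ∞)`. -/
lemma norm_mollify_pow_le {F : Type} [NormedAddCommGroup F] [NormedSpace ℝ F] [CompleteSpace F]
    (φ : ContDiffBump (0 : Eucl n)) {G : Eucl n → F} (hG : Integrable G) (p : ℕ)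
    (hGp : Integrable fun y ↦ ‖G y‖ ^ p) (x : Eucl n) :
    ‖(φ.normed volume ⋆[lsmul ℝ ℝ, volume] G) x‖ ^ p ≤
      (φ.normed volume ⋆[lsmul ℝ ℝ, volume] fun y ↦ ‖G y‖ ^ p) x := by
  have hex : ∀ {F' : Type} [NormedAddCommGroup F'] [NormedSpace ℝ F'] {H : Eucl n → F'},
      Integrable H → Integrable fun t ↦ φ.normed volume t • H (x - t) := fun hH ↦
    φ.hasCompactSupport_normed.convolutionExists_left (lsmul ℝ ℝ) φ.continuous_normed
      hH.locallyIntegrable x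
  set d : Eucl n → ENNReal := fun t ↦ ENNReal.ofReal (φ.normed volume t) with hd
  have hdm : Measurable d := φ.continuous_normed.measurable.ennreal_ofReal
  have hdt : ∀ᵐ t ∂(volume : Measure (Eucl n)), d t < ⊤ :=
    Eventually.of_forall fun t ↦ ENNReal.ofReal_lt_top
  have hdr : ∀ t, (d t).toReal = φ.normed volume t := fun t ↦
    ENNReal.toReal_ofReal (φ.nonneg_normed t)
  set ν := (volume : Measure (Eucl n)).withDensity d with hν
  have hprob : IsProbabilityMeasure ν := by
    refine ⟨?_⟩
    rw [hν, withDensity_apply _ MeasurableSet.univ, Measure.restrict_univ, hd,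
      ← ofReal_integral_eq_lintegral_ofReal φ.integrable_normed
        (Eventually.of_forall φ.nonneg_normed), φ.integral_normed, ENNReal.ofReal_one]
  have hint : ∀ {F' : Type} [NormedAddCommGroup F'] [NormedSpace ℝ F'] (H : Eucl n → F'),
      (φ.normed volume ⋆[lsmul ℝ ℝ, volume] H) x = ∫ t, H (x - t) ∂ν := by
    intro F' _ _ H
    rw [hν, integral_withDensity_eq_integral_toReal_smul hdm hdt, convolution_def]
    simp [hdr]
  have hintg : ∀ {F' : Type} [NormedAddCommGroup F'] [NormedSpace ℝ F'] {H : Eucl n → F'},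
      Integrable H → Integrable (fun t ↦ H (x - t)) ν := by
    intro F' _ _ H hH
    rw [hν, integrable_withDensity_iff_integrable_smul' hdm hdt]
    simpa [hdr] using hex hH
  have hGν := hintg (H := fun y ↦ ‖G y‖ ^ p) hGp
  rw [hint, hint]
  calc ‖∫ t, G (x - t) ∂ν‖ ^ p ≤ (∫ t, ‖G (x - t)‖ ∂ν) ^ p :=
        pow_le_pow_left₀ (norm_nonneg _) (norm_integral_le_integral_norm _) p
    _ ≤ ∫ t, ‖G (x - t)‖ ^ p ∂ν :=
        (convexOn_pow p).map_integral_le (continuous_pow p).continuousOn isClosed_Ici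
          (Eventually.of_forall fun t ↦ norm_nonneg _) (hintg hG).norm hGν

lemma integrable_indicator_of_isCompact {F : Type*} [NormedAddCommGroup F] {G : Eucl n → F}
    {C : Set (Eucl n)} (hC : IsCompact C) (hG : IntegrableOn G C) : Integrable (C.indicator G) :=
  hG.integrable_indicator hC.measurableSet

lemma integrableOn_zero_fun (F : Type*) [NormedAddCommGroup F] (C : Set (Eucl n)) :
    IntegrableOn (fun _ ↦ (0 : F)) C :=
  integrableOn_zero

/-- The derivative of the convolution falls on the bump. Using `ζ y = φ (x - y)` as test function in
the definition of weak derivative moves it onto `G`. The ball condition keeps the support of `ζ`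
inside `C`, where cutting `u` and `G` off by the indicator changes nothing. -/
lemma hasFDerivAt_mollify {u : Eucl n → Eucl m} {G : Eucl n → Eucl n →L[ℝ] Eucl m}
    {O C : Set (Eucl n)} (hw : IsWeakDerivOn u G O) (hCO : C ⊆ O) (hC : IsCompact C)
    (huC : ContinuousOn u C) (hGC : IntegrableOn G C) (φ : ContDiffBump (0 : Eucl n))
    {x : Eucl n} (hx : closedBall x φ.rOut ⊆ C) :
    HasFDerivAt (φ.normed volume ⋆[lsmul ℝ ℝ, volume] C.indicator u)
      ((φ.normed volume ⋆[lsmul ℝ ℝ, volume] C.indicator G) x) x := by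
  have hui : Integrable (C.indicator u) :=
    (huC.integrableOn_compact hC).integrable_indicator hC.measurableSet
  have hGi : Integrable (C.indicator G) := integrable_indicator_of_isCompact hC hGC
  have hφ1 : ContDiff ℝ 1 (φ.normed (volume : Measure (Eucl n))) := φ.contDiff_normed
  have h := φ.hasCompactSupport_normed.hasFDerivAt_convolution_left (lsmul ℝ ℝ) hφ1
    hui.locallyIntegrable x
  suffices hkey : (φ.normed volume ⋆[lsmul ℝ ℝ, volume] C.indicator G) x =
      (fderiv ℝ (φ.normed volume) ⋆[(lsmul ℝ ℝ).precompL (Eucl n), volume] C.indicator u) x by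
    rw [hkey]; exact h
  refine ContinuousLinearMap.ext fun v ↦ ?_
  have e1 : Integrable fun t ↦ (lsmul ℝ ℝ) (φ.normed volume t) (C.indicator G (x - t)) :=
    φ.hasCompactSupport_normed.convolutionExists_left (lsmul ℝ ℝ) φ.continuous_normed
      hGi.locallyIntegrable x
  have e2 : Integrable fun t ↦ ((lsmul ℝ ℝ).precompL (Eucl n))
      (fderiv ℝ (φ.normed volume) t) (C.indicator u (x - t)) :=
    (φ.hasCompactSupport_normed.fderiv ℝ).convolutionExists_left _
      (hφ1.continuous_fderiv one_ne_zero) hui.locallyIntegrable x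
  rw [convolution_def, convolution_def, ContinuousLinearMap.integral_apply e1,
    ContinuousLinearMap.integral_apply e2]
  set ζ : Eucl n → ℝ := fun y ↦ φ.normed volume (x - y) with hζ
  have hζ0 : ∀ y ∉ closedBall x φ.rOut, ζ y = 0 := by
    intro y hy
    have : x - y ∉ tsupport (φ.normed (volume : Measure (Eucl n))) := by
      rw [φ.tsupport_normed_eq]
      simpa [dist_eq_norm, norm_sub_rev] using hy
    exact image_eq_zero_of_notMem_tsupport (f := φ.normed volume) this
  have hζt : tsupport ζ ⊆ closedBall x φ.rOut :=
    closure_minimal (fun y hy ↦ by_contra fun h ↦ hy (hζ0 y h)) isClosed_closedBall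
  have hζs : ContDiff ℝ ∞ ζ := φ.contDiff_normed.comp (contDiff_const.sub contDiff_id)
  have hζc : HasCompactSupport ζ :=
    (isCompact_closedBall x φ.rOut).of_isClosed_subset (isClosed_tsupport _) hζt
  have hdζ : ∀ y, fderiv ℝ ζ y v = -fderiv ℝ (φ.normed volume) (x - y) v := by
    intro y
    have h1 : HasFDerivAt (fun y : Eucl n ↦ x - y) (-ContinuousLinearMap.id ℝ (Eucl n)) y := by
      simpa using! (hasFDerivAt_id (𝕜 := ℝ) y).const_sub x
    have h2 := ((hφ1.differentiable one_ne_zero) (x - y)).hasFDerivAt.comp y h1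
    have h3 : fderiv ℝ ζ y = _ := h2.fderiv
    rw [h3]; simp
  have hweak := hw ζ hζs hζc (hζt.trans (hx.trans hCO)) v
  -- The substitution `t ↦ x - t` turns both convolutions into integrals against `ζ` and its
  -- derivative. The sign in `hdζ` cancels the one in the weak derivative.
  rw [← integral_sub_left_eq_self _ _ x, ← integral_sub_left_eq_self
    (fun t ↦ ((lsmul ℝ ℝ).precompL (Eucl n) (fderiv ℝ (φ.normed volume) t)
      (C.indicator u (x - t))) v) _ x]
  have i1 : ∀ y, (((lsmul ℝ ℝ) (φ.normed volume (x - y))) (C.indicator G (x - (x - y)))) v =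
      ζ y • G y v := by
    intro y
    rw [sub_sub_cancel]
    by_cases hy : y ∈ C
    · simp [hy, hζ]
    · simp [hy, hζ0 y fun h ↦ hy (hx h)]
  have i2 : ∀ y, (((lsmul ℝ ℝ).precompL (Eucl n) (fderiv ℝ (φ.normed volume) (x - y)))
      (C.indicator u (x - (x - y)))) v = -(fderiv ℝ ζ y v • u y) := by
    intro y
    rw [sub_sub_cancel, hdζ]
    by_cases hy : y ∈ C
    · simp [hy, ContinuousLinearMap.precompL_apply]
    · have h0 : fderiv ℝ ζ y = 0 :=
        image_eq_zero_of_notMem_tsupport fun h ↦ hy (hx (hζt (tsupport_fderiv_subset ℝ h)))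
      have h1 := hdζ y
      rw [h0] at h1
      simp [hy, ← h1]
  simp only [i1, i2]
  rw [integral_neg, hweak, neg_neg]

lemma integrableOn_of_memLp {p : ℕ} (hp : p ≠ 0) {F : Type*} [NormedAddCommGroup F]
    {G : Eucl n → F} {C : Set (Eucl n)} (hC : IsCompact C) (hG : MemLp G p (volume.restrict C)) :
    IntegrableOn G C ∧ IntegrableOn (fun y ↦ ‖G y‖ ^ p) C := by
  have : IsFiniteMeasure ((volume : Measure (Eucl n)).restrict C) :=
    ⟨by simpa using hC.measure_lt_top⟩
  refine ⟨hG.integrable (by exact_mod_cast Nat.one_le_iff_ne_zero.2 hp), ?_⟩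
  exact hG.integrable_norm_pow hp

/-- Smooth approximations of a continuous Sobolev map near a compact set: they converge pointwise,
their derivatives converge almost everywhere, and the `p`-th powers of the norms of the derivatives
are dominated by functions that converge together with their integrals. -/
lemma exists_smooth_approx {p : ℕ} (hp : p ≠ 0) {u : Eucl n → Eucl m}
    {G : Eucl n → Eucl n →L[ℝ] Eucl m} {O C' : Set (Eucl n)} (hO : IsOpen O)
    (hu : ContinuousOn u O) (hw : IsWeakDerivOn u G O)
    (hG : ∀ C : Set (Eucl n), IsCompact C → C ⊆ O → MemLp G p (volume.restrict C))
    (hC' : IsCompact C') (hC'O : C' ⊆ O) :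
    ∃ (v : ℕ → Eucl n → Eucl m) (g : ℕ → Eucl n → ℝ) (g' : Eucl n → ℝ),
      (∀ j, ContDiff ℝ ∞ (v j)) ∧
      (∀ x ∈ C', Tendsto (fun j ↦ v j x) atTop (𝓝 (u x))) ∧
      (∀ᵐ x, x ∈ C' → Tendsto (fun j ↦ fderiv ℝ (v j) x) atTop (𝓝 (G x))) ∧
      (∀ j, Integrable (g j)) ∧ Integrable g' ∧ (∀ j x, 0 ≤ g j x) ∧
      (∀ᵐ x, Tendsto (fun j ↦ g j x) atTop (𝓝 (g' x))) ∧
      Tendsto (fun j ↦ ∫ x, g j x) atTop (𝓝 (∫ x, g' x)) ∧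
      ∀ j, ∀ x ∈ C', ‖fderiv ℝ (v j) x‖ ^ p ≤ g j x := by
  -- The margin `δ` ensures that mollification at radius at most `δ`, evaluated on `C'`, only sees
  -- values in the compact set `C ⊆ O`.
  obtain ⟨δ, hδ, hδO⟩ := hC'.exists_cthickening_subset_open hO hC'O
  set C := cthickening δ C' with hCdef
  have hC : IsCompact C := hC'.cthickening
  have hballC : ∀ x ∈ C', closedBall x δ ⊆ C := fun x hx ↦ closedBall_subset_cthickening hx δ
  obtain ⟨hG1, hGp⟩ := integrableOn_of_memLp hp hC (hG C hC hδO)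
  have huC : ContinuousOn u C := hu.mono hδO
  have hui : Integrable (C.indicator u) :=
    (huC.integrableOn_compact hC).integrable_indicator hC.measurableSet
  have hGi : Integrable (C.indicator G) := integrable_indicator_of_isCompact hC hG1
  have hGpi : Integrable fun y ↦ ‖C.indicator G y‖ ^ p := by
    have := hGp.integrable_indicator hC.measurableSet
    refine this.congr (Eventually.of_forall fun y ↦ ?_)
    by_cases hy : y ∈ C <;> simp [hy, hp]
  have hpos : ∀ j : ℕ, 0 < δ / (j + 1) := fun j ↦ by positivity
  set φ : ℕ → ContDiffBump (0 : Eucl n) := fun j ↦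
    ⟨δ / (j + 1) / 2, δ / (j + 1), half_pos (hpos j), half_lt_self (hpos j)⟩ with hφ
  have hφ0 : Tendsto (fun j ↦ (φ j).rOut) atTop (𝓝 0) :=
    tendsto_const_div_atTop_nhds_zero_nat δ |>.comp (tendsto_add_atTop_nat 1) |>.congr
      fun j ↦ by simp [hφ]
  -- Comparable inner and outer radii let the Lebesgue differentiation theorem yield almost
  -- everywhere convergence for merely integrable functions.
  have hφK : ∀ᶠ j in atTop, (φ j).rOut ≤ 2 * (φ j).rIn :=
    Eventually.of_forall fun j ↦ by simp only [hφ]; linarith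
  have hφδ : ∀ j, (φ j).rOut ≤ δ := fun j ↦ by
    simp only [hφ]
    exact div_le_self hδ.le (by simp)
  have hder : ∀ j, ∀ x ∈ C',
      HasFDerivAt ((φ j).normed volume ⋆[lsmul ℝ ℝ, volume] C.indicator u)
        (((φ j).normed volume ⋆[lsmul ℝ ℝ, volume] C.indicator G) x) x := fun j x hx ↦
    hasFDerivAt_mollify hw hδO hC huC hG1 (φ j)
      ((closedBall_subset_closedBall (hφδ j)).trans (hballC x hx))
  refine ⟨fun j ↦ (φ j).normed volume ⋆[lsmul ℝ ℝ, volume] C.indicator u,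
    fun j ↦ (φ j).normed volume ⋆[lsmul ℝ ℝ, volume] fun y ↦ ‖C.indicator G y‖ ^ p,
    fun y ↦ ‖C.indicator G y‖ ^ p, fun j ↦ ?_, fun x hx ↦ ?_, ?_, fun j ↦ ?_, hGpi, fun j x ↦ ?_,
    ?_, ?_, fun j x hx ↦ ?_⟩
  · exact (φ j).hasCompactSupport_normed.contDiff_convolution_left _ (φ j).contDiff_normed
      hui.locallyIntegrable
  · have hev : C.indicator u =ᶠ[𝓝 x] u := by
      filter_upwards [closedBall_mem_nhds x hδ] with y hy
      exact indicator_of_mem (hballC x hx hy) u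
    have hcx : ContinuousAt (C.indicator u) x :=
      (hu.continuousAt (hO.mem_nhds (hC'O hx))).congr hev.symm
    have h := ContDiffBump.convolution_tendsto_right (μ := volume) (g := fun _ : ℕ ↦ C.indicator u)
      (k := fun _ ↦ x) (z₀ := C.indicator u x) hφ0
      (Eventually.of_forall fun _ ↦ hui.1) (hcx.tendsto.comp tendsto_snd) tendsto_const_nhds
    rwa [hev.eq_of_nhds] at h
  · filter_upwards [ContDiffBump.ae_convolution_tendsto_right_of_locallyIntegrable hφ0 hφK
      hGi.locallyIntegrable] with x hx hxC
    rw [indicator_of_mem (hballC x hxC (mem_closedBall_self hδ.le))] at hx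
    exact hx.congr fun j ↦ (hder j x hxC).fderiv.symm
  · exact (φ j).integrable_normed.integrable_convolution _ hGpi
  · exact integral_nonneg fun t ↦ mul_nonneg ((φ j).nonneg_normed t) (by positivity)
  · exact ContDiffBump.ae_convolution_tendsto_right_of_locallyIntegrable hφ0 hφK
      hGpi.locallyIntegrable
  -- Convolution with a density of mass one preserves the integral, so the integrals of the bounds
  -- do not depend on `j`.
  · have : ∀ j, ∫ x, ((φ j).normed volume ⋆[lsmul ℝ ℝ, volume] fun y ↦ ‖C.indicator G y‖ ^ p) x =
        ∫ y, ‖C.indicator G y‖ ^ p := fun j ↦ by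
      rw [integral_convolution _ (φ j).integrable_normed hGpi, (φ j).integral_normed]
      simp
    simp only [this]
    exact tendsto_const_nhds
  · rw [(hder j x hx).fderiv]
    exact norm_mollify_pow_le (φ j) hGi p hGpi x

/-- A continuous map whose weak derivative vanishes is locally constant. -/
lemma eventually_eq_of_weakDeriv_eq_zero {u : Eucl n → Eucl m}
    {G : Eucl n → Eucl n →L[ℝ] Eucl m} {O : Set (Eucl n)} (hO : IsOpen O)
    (hu : ContinuousOn u O) (hw : IsWeakDerivOn u G O) (hG : ∀ᵐ y, y ∈ O → G y = 0) {x : Eucl n}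
    (hx : x ∈ O) : ∀ᶠ y in 𝓝 x, u y = u x := by
  have hw0 : IsWeakDerivOn u (fun _ ↦ 0) O := by
    intro φ h1 h2 h3 v
    rw [hw φ h1 h2 h3 v]
    congr 1
    refine integral_congr_ae ?_
    filter_upwards [hG] with y hy
    by_cases hyO : y ∈ O
    · simp [hy hyO]
    · simp [image_eq_zero_of_notMem_tsupport fun h ↦ hyO (h3 h)]
  obtain ⟨r, hr, hrO⟩ := Metric.nhds_basis_closedBall.mem_iff.1 (hO.mem_nhds hx)
  set C := closedBall x r with hCdef
  have hC : IsCompact C := isCompact_closedBall x r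
  have huC : ContinuousOn u C := hu.mono hrO
  have hui : Integrable (C.indicator u) :=
    (huC.integrableOn_compact hC).integrable_indicator hC.measurableSet
  have hpos : ∀ j : ℕ, 0 < r / 2 / (j + 1) := fun j ↦ by positivity
  set φ : ℕ → ContDiffBump (0 : Eucl n) := fun j ↦
    ⟨r / 2 / (j + 1) / 2, r / 2 / (j + 1), half_pos (hpos j), half_lt_self (hpos j)⟩ with hφ
  have hφ0 : Tendsto (fun j ↦ (φ j).rOut) atTop (𝓝 0) :=
    tendsto_const_div_atTop_nhds_zero_nat (r / 2) |>.comp (tendsto_add_atTop_nat 1) |>.congr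
      fun j ↦ by simp [hφ]
  have hφr : ∀ j, (φ j).rOut ≤ r / 2 := fun j ↦ by
    simp only [hφ]
    exact div_le_self (by positivity) (by simp)
  -- With radii at most `r / 2`, mollification at points of the half ball stays inside `C`. Each
  -- mollification therefore has zero derivative there and is constant, and continuity of `u` passes
  -- this to the limit.
  have hder : ∀ j, ∀ y ∈ ball x (r / 2),
      HasFDerivAt ((φ j).normed volume ⋆[lsmul ℝ ℝ, volume] C.indicator u)
        (0 : Eucl n →L[ℝ] Eucl m) y := by
    intro j y hy
    have h := hasFDerivAt_mollify (G := fun _ ↦ 0) hw0 hrO hC huC (integrableOn_zero_fun _ C) (φ j) (x := y) (by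
      refine closedBall_subset_closedBall' ?_
      linarith [hφr j, mem_ball.1 hy])
    have h0 : C.indicator (fun _ ↦ (0 : Eucl n →L[ℝ] Eucl m)) = 0 := indicator_zero _ _
    rwa [h0, convolution_zero] at h
  have hlim : ∀ y ∈ ball x (r / 2), Tendsto
      (fun j ↦ ((φ j).normed volume ⋆[lsmul ℝ ℝ, volume] C.indicator u) y) atTop (𝓝 (u y)) := by
    intro y hy
    have hyr : y ∈ ball x r := ball_subset_ball (by linarith) hy
    have hev : C.indicator u =ᶠ[𝓝 y] u := by
      filter_upwards [isOpen_ball.mem_nhds hyr] with z hz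
      exact indicator_of_mem (ball_subset_closedBall hz) u
    have hcy : ContinuousAt (C.indicator u) y :=
      (hu.continuousAt (hO.mem_nhds (hrO (ball_subset_closedBall hyr)))).congr hev.symm
    have h := ContDiffBump.convolution_tendsto_right (μ := volume) (g := fun _ : ℕ ↦ C.indicator u)
      (k := fun _ ↦ y) (z₀ := C.indicator u y) hφ0
      (Eventually.of_forall fun _ ↦ hui.1) (hcy.tendsto.comp tendsto_snd) tendsto_const_nhds
    rwa [hev.eq_of_nhds] at h
  have hx2 : x ∈ ball x (r / 2) := mem_ball_self (by positivity)
  filter_upwards [ball_mem_nhds x (half_pos hr)] with y hy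
  refine tendsto_nhds_unique (hlim y hy) ((hlim x hx2).congr fun j ↦ ?_)
  exact isOpen_ball.is_const_of_fderiv_eq_zero (convex_ball x (r / 2)).isPreconnected
    (fun z hz ↦ (hder j z hz).differentiableAt.differentiableWithinAt)
    (fun z hz ↦ (hder j z hz).fderiv) hx2 hy

end Mollification

/-! ### Stokes' theorem for pullbacks by Sobolev maps in Euclidean space -/

section LocalStokes

variable {n m : ℕ}

/-- This lets `p`-integrability of the derivative control pullbacks of forms of any degree `l ≤ p`
on compact sets, where the constant `1` is integrable. -/
lemma pow_le_one_add_pow {a : ℝ} (ha : 0 ≤ a) {l p : ℕ} (hlp : l ≤ p) : a ^ l ≤ 1 + a ^ p := by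
  rcases le_total a 1 with h | h
  · linarith [pow_le_one₀ ha h (n := l), pow_nonneg ha p]
  · linarith [pow_le_pow_right₀ h hlp]

/-- Integrability of the pullback of a form with continuous coefficients by a Sobolev map. -/
lemma integrable_mul_form_apply {p : ℕ} (hp : p ≠ 0) {G : Eucl n → Eucl n →L[ℝ] Eucl m}
    {O : Set (Eucl n)}
    (hG : ∀ C : Set (Eucl n), IsCompact C → C ⊆ O → MemLp G p (volume.restrict C))
    {l : ℕ} (hlp : l ≤ p) {A : Eucl n → Eucl m [⋀^Fin l]→L[ℝ] ℝ} (hA : ContinuousOn A O)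
    {a : Eucl n → ℝ} (ha : Continuous a) (hac : HasCompactSupport a) (haO : tsupport a ⊆ O)
    {w : Fin l → Eucl n} (hw : ∀ i, ‖w i‖ ≤ 1) :
    Integrable fun y ↦ a y * A y fun i ↦ G y (w i) := by
  set C := tsupport a with hC
  have hCc : IsCompact C := hac.isCompact
  have hAC : ContinuousOn A C := hA.mono haO
  have hGC := hG C hCc haO
  obtain ⟨B, hB⟩ := hCc.exists_bound_of_continuousOn hAC
  obtain ⟨D, hD⟩ := hCc.exists_bound_of_continuousOn ha.continuousOn
  have hsupp : Function.support (fun y ↦ a y * A y fun i ↦ G y (w i)) ⊆ C := by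
    intro y hy
    refine subset_tsupport a fun h ↦ hy ?_
    simp [h]
  rw [← integrableOn_iff_integrable_of_support_subset hsupp]
  have hfin : IsFiniteMeasure ((volume : Measure (Eucl n)).restrict C) :=
    ⟨by simpa using hCc.measure_lt_top⟩
  have hbound : IntegrableOn (fun y ↦ D * (B * (1 + ‖G y‖ ^ p))) C :=
    (((integrable_const (1 : ℝ)).add (integrableOn_of_memLp hp hCc hGC).2).const_mul B).const_mul D
  have hAm : AEStronglyMeasurable A (volume.restrict C) :=
    hAC.aestronglyMeasurable hCc.measurableSet
  have hm : AEStronglyMeasurable (fun y ↦ a y * A y fun i ↦ G y (w i)) (volume.restrict C) :=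
    ha.aestronglyMeasurable.mul
      ((continuous_apply_forms w).comp_aestronglyMeasurable (hAm.prodMk hGC.1))
  refine hbound.mono' hm ((ae_restrict_iff' hCc.measurableSet).2 (Eventually.of_forall ?_))
  intro y hy
  have h1 : |A y fun i ↦ G y (w i)| ≤ B * (1 + ‖G y‖ ^ p) :=
    (abs_form_apply_le (A y) (G y) hw).trans (mul_le_mul (hB y hy)
      (pow_le_one_add_pow (norm_nonneg _) hlp) (by positivity) ((norm_nonneg _).trans (hB y hy)))
  rw [norm_mul]
  exact mul_le_mul (hD y hy) h1 (abs_nonneg _) ((norm_nonneg _).trans (hD y hy))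

/-- Convergence of the pullbacks of a bounded form along smooth approximations. -/
lemma tendsto_integral_form_apply {p : ℕ} {u : Eucl n → Eucl m}
    {G : Eucl n → Eucl n →L[ℝ] Eucl m} {C : Set (Eucl n)} (hC : IsCompact C)
    {v : ℕ → Eucl n → Eucl m} {g : ℕ → Eucl n → ℝ} {g' : Eucl n → ℝ}
    (hv : ∀ j, ContDiff ℝ ∞ (v j))
    (hvu : ∀ x ∈ C, Tendsto (fun j ↦ v j x) atTop (𝓝 (u x)))
    (hvG : ∀ᵐ x, x ∈ C → Tendsto (fun j ↦ fderiv ℝ (v j) x) atTop (𝓝 (G x)))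
    (hg : ∀ j, Integrable (g j)) (hg' : Integrable g') (hg0 : ∀ j x, 0 ≤ g j x)
    (hgg' : ∀ᵐ x, Tendsto (fun j ↦ g j x) atTop (𝓝 (g' x)))
    (hint : Tendsto (fun j ↦ ∫ x, g j x) atTop (𝓝 (∫ x, g' x)))
    (hvg : ∀ j, ∀ x ∈ C, ‖fderiv ℝ (v j) x‖ ^ p ≤ g j x)
    {l : ℕ} (hlp : l ≤ p) {T : Eucl m → Eucl m [⋀^Fin l]→L[ℝ] ℝ} (hT : Continuous T) {B : ℝ}
    (hB : ∀ z, ‖T z‖ ≤ B) {a : Eucl n → ℝ} (ha : Continuous a) (haC : tsupport a ⊆ C)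
    {w : Fin l → Eucl n} (hw : ∀ i, ‖w i‖ ≤ 1) :
    Tendsto (fun j ↦ ∫ y, a y * T (v j y) fun i ↦ fderiv ℝ (v j) y (w i)) atTop
      (𝓝 (∫ y, a y * T (u y) fun i ↦ G y (w i))) := by
  obtain ⟨D, hD⟩ := hC.exists_bound_of_continuousOn ha.continuousOn
  have hB0 : 0 ≤ B := (norm_nonneg _).trans (hB 0)
  have ha0 : ∀ y ∉ C, a y = 0 := fun y hy ↦ image_eq_zero_of_notMem_tsupport fun h ↦ hy (haC h)
  -- If `C` is empty, `D` may be negative, while the bound must be nonnegative off `C`.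
  set D' := max D 0 with hD'
  have hone : Integrable (C.indicator fun _ ↦ (1 : ℝ)) :=
    (integrable_indicator_iff hC.measurableSet).2 (integrableOn_const hC.measure_lt_top.ne)
  refine tendsto_integral_of_tendsto_dominating
    -- The indicator replaces the `1` of `1 + ‖Dv_j‖ ^ p`, which is not integrable on the whole
    -- space. This loses nothing, since `a` vanishes off `C`.
    (g := fun j y ↦ D' * (B * (C.indicator (fun _ ↦ (1 : ℝ)) y + g j y)))
    (g' := fun y ↦ D' * (B * (C.indicator (fun _ ↦ (1 : ℝ)) y + g' y)))
    (fun j ↦ ?_) (fun j ↦ ((hone.add (hg j)).const_mul B).const_mul D')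
    ((hone.add hg').const_mul B |>.const_mul D') (fun j ↦ ?_) ?_ ?_ ?_
  · refine Continuous.aestronglyMeasurable (ha.mul ?_)
    exact (continuous_apply_forms w).comp
      ((hT.comp (hv j).continuous).prodMk ((hv j).continuous_fderiv (by simp)))
  · refine Eventually.of_forall fun y ↦ ?_
    by_cases hy : y ∈ C
    · have h1 : |T (v j y) fun i ↦ fderiv ℝ (v j) y (w i)| ≤ B * (1 + g j y) :=
        (abs_form_apply_le _ _ hw).trans (mul_le_mul (hB _)
          ((pow_le_one_add_pow (norm_nonneg _) hlp).trans (by linarith [hvg j y hy]))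
          (by positivity) hB0)
      rw [abs_mul, indicator_of_mem hy]
      exact mul_le_mul ((hD y hy).trans (le_max_left _ _)) h1 (abs_nonneg _) (le_max_right _ _)
    · rw [ha0 y hy, zero_mul, abs_zero, indicator_of_notMem hy, zero_add]
      exact mul_nonneg (le_max_right _ _) (mul_nonneg hB0 (hg0 j y))
  · filter_upwards [hvG] with y hy
    by_cases hyC : y ∈ C
    · have h1 : Tendsto (fun j ↦ (T (v j y), fderiv ℝ (v j) y)) atTop (𝓝 (T (u y), G y)) :=
        ((hT.tendsto _).comp (hvu y hyC)).prodMk_nhds (hy hyC)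
      exact (((continuous_apply_forms w).tendsto _).comp h1).const_mul (a y)
    · simp only [ha0 y hyC, zero_mul]
      exact tendsto_const_nhds
  · filter_upwards [hgg'] with y hy
    exact ((hy.const_add _).const_mul _).const_mul _
  · simp only [integral_const_mul]
    have h1 : ∀ h : Eucl n → ℝ, Integrable h →
        ∫ y, (C.indicator (fun _ ↦ (1 : ℝ)) y + h y) =
          (∫ y, C.indicator (fun _ ↦ (1 : ℝ)) y) + ∫ y, h y := fun h hh ↦ integral_add hone hh
    simp only [h1 _ (hg _), h1 _ hg']
    exact ((hint.const_add _).const_mul _).const_mul _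

lemma continuous_extDeriv {k : ℕ} {T : Eucl m → Eucl m [⋀^Fin k]→L[ℝ] ℝ} (hT : ContDiff ℝ ∞ T) :
    Continuous (extDeriv T) :=
  (ContinuousAlternatingMap.alternatizeUncurryFinCLM ℝ (Eucl m) ℝ).continuous.comp
    (hT.continuous_fderiv (by simp))

lemma tsupport_extDeriv_subset {k : ℕ} (T : Eucl m → Eucl m [⋀^Fin k]→L[ℝ] ℝ) :
    tsupport (extDeriv T) ⊆ tsupport T := by
  refine (closure_minimal ?_ (isClosed_tsupport _))
  intro y hy
  refine support_fderiv_subset ℝ fun h ↦ hy ?_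
  have h0 : fderiv ℝ T y = 0 := h
  simp only [extDeriv, h0]
  exact (ContinuousAlternatingMap.alternatizeUncurryFinCLM ℝ (Eucl m) ℝ).map_zero

/-- Stokes' theorem for the pullback of a compactly supported smooth form by a Sobolev map. -/
lemma integral_mul_extDeriv_of_hasCompactSupport {k : ℕ} {u : Eucl n → Eucl m}
    {G : Eucl n → Eucl n →L[ℝ] Eucl m} {O : Set (Eucl n)} (hO : IsOpen O)
    (hu : ContinuousOn u O) (hw : IsWeakDerivOn u G O)
    (hG : ∀ C : Set (Eucl n), IsCompact C → C ⊆ O → MemLp G (k + 1 : ℕ) (volume.restrict C))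
    {T : Eucl m → Eucl m [⋀^Fin k]→L[ℝ] ℝ} (hT : ContDiff ℝ ∞ T) (hTc : HasCompactSupport T)
    {ψ : Eucl n → ℝ} (hψ : ContDiff ℝ ∞ ψ) (hψc : HasCompactSupport ψ) (hψO : tsupport ψ ⊆ O)
    {w : Fin (k + 1) → Eucl n} (hw1 : ∀ i, ‖w i‖ ≤ 1) :
    ∫ y, ψ y * extDeriv T (u y) (fun i ↦ G y (w i)) =
      -∫ y, oneWedge (fderiv ℝ ψ y) ((T (u y)).compContinuousLinearMap (G y)) w := by
  obtain ⟨v, g, g', hv, hvu, hvG, hg, hg', hg0, hgg', hint, hvg⟩ :=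
    exists_smooth_approx (p := k + 1) (by simp) hO hu hw hG hψc.isCompact hψO
  have hdT := continuous_extDeriv hT
  have hdTc : HasCompactSupport (extDeriv T) :=
    hTc.of_isClosed_subset (isClosed_tsupport _) (tsupport_extDeriv_subset T)
  obtain ⟨B, hB⟩ := hTc.exists_bound_of_continuous hT.continuous
  obtain ⟨B', hB'⟩ := hdTc.exists_bound_of_continuous hdT
  have hdψ : ∀ i : Fin (k + 1), Continuous fun y ↦ fderiv ℝ ψ y (w i) := fun i ↦
    (hψ.continuous_fderiv (by simp)).clm_apply continuous_const
  have hdψs : ∀ i : Fin (k + 1), tsupport (fun y ↦ fderiv ℝ ψ y (w i)) ⊆ tsupport ψ := fun i ↦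
    tsupport_fderiv_apply_subset ℝ (w i)
  have hw2 : ∀ (i : Fin (k + 1)) (l : Fin k), ‖i.removeNth w l‖ ≤ 1 := fun i l ↦ hw1 _
  have lhs := tendsto_integral_form_apply hψc.isCompact hv hvu hvG hg hg' hg0 hgg' hint hvg le_rfl
    hdT hB' hψ.continuous subset_rfl hw1
  have rhs := fun i : Fin (k + 1) ↦ tendsto_integral_form_apply hψc.isCompact hv hvu hvG hg hg' hg0
    hgg' hint hvg (Nat.le_succ k) hT.continuous hB (hdψ i) (hdψs i) (hw2 i)
  -- Stated for arbitrary `u` and `G`, because it is needed both for the limit map and for each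
  -- smooth approximation.
  have expand : ∀ (u : Eucl n → Eucl m) (G : Eucl n → Eucl n →L[ℝ] Eucl m), ContinuousOn u O →
      (∀ C : Set (Eucl n), IsCompact C → C ⊆ O → MemLp G (k + 1 : ℕ) (volume.restrict C)) →
      ∫ y, oneWedge (fderiv ℝ ψ y) ((T (u y)).compContinuousLinearMap (G y)) w =
        ∑ i : Fin (k + 1), (-1) ^ i.val *
          ∫ y, fderiv ℝ ψ y (w i) * T (u y) fun l ↦ G y (i.removeNth w l) := by
    intro u G hu hG
    simp only [oneWedge_apply]
    rw [integral_finsetSum]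
    · refine Finset.sum_congr rfl fun i _ ↦ ?_
      rw [integral_const_mul]
      rfl
    · intro i _
      refine Integrable.const_mul ?_ _
      exact integrable_mul_form_apply (by simp) hG (Nat.le_succ k)
        (hT.continuous.comp_continuousOn hu) (hdψ i)
        (hψc.of_isClosed_subset (isClosed_tsupport _) (hdψs i)) ((hdψs i).trans hψO) (hw2 i)
  have hvL : ∀ j, ∀ C : Set (Eucl n), IsCompact C → C ⊆ O →
      MemLp (fderiv ℝ (v j)) (k + 1 : ℕ) (volume.restrict C) := by
    intro j C hC _
    have hfin : IsFiniteMeasure ((volume : Measure (Eucl n)).restrict C) :=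
      ⟨by simpa using hC.measure_lt_top⟩
    have hc : Continuous (fderiv ℝ (v j)) := (hv j).continuous_fderiv (by simp)
    obtain ⟨R, hR⟩ := hC.exists_bound_of_continuousOn hc.continuousOn
    exact MemLp.of_bound hc.aestronglyMeasurable R
      ((ae_restrict_iff' hC.measurableSet).2 (Eventually.of_forall hR))
  rw [expand u G hu hG]
  have rhs' := (tendsto_finsetSum Finset.univ
    fun i _ ↦ (rhs i).const_mul ((-1 : ℝ) ^ (i : Fin (k + 1)).val)).neg
  refine tendsto_nhds_unique lhs (rhs'.congr fun j ↦ ?_)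
  rw [← expand (v j) (fderiv ℝ (v j)) (hv j).continuous.continuousOn (hvL j)]
  exact (integral_mul_extDeriv_pullback volume hT (hv j) hψ hψc w).symm

/-- Stokes' theorem for the pullback of a smooth form by a Sobolev map. -/
lemma integral_mul_extDeriv {k : ℕ} {u : Eucl n → Eucl m}
    {G : Eucl n → Eucl n →L[ℝ] Eucl m} {O : Set (Eucl n)} (hO : IsOpen O)
    (hu : ContinuousOn u O) (hw : IsWeakDerivOn u G O)
    (hG : ∀ C : Set (Eucl n), IsCompact C → C ⊆ O → MemLp G (k + 1 : ℕ) (volume.restrict C))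
    {V : Set (Eucl m)} (hV : IsOpen V) (huV : MapsTo u O V)
    {T : Eucl m → Eucl m [⋀^Fin k]→L[ℝ] ℝ} (hT : ContDiffOn ℝ ∞ T V)
    {ψ : Eucl n → ℝ} (hψ : ContDiff ℝ ∞ ψ) (hψc : HasCompactSupport ψ) (hψO : tsupport ψ ⊆ O)
    {w : Fin (k + 1) → Eucl n} (hw1 : ∀ i, ‖w i‖ ≤ 1) :
    ∫ y, ψ y * extDeriv T (u y) (fun i ↦ G y (w i)) =
      -∫ y, oneWedge (fderiv ℝ ψ y) ((T (u y)).compContinuousLinearMap (G y)) w := by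
  set Q := u '' tsupport ψ with hQ
  have hQc : IsCompact Q := hψc.isCompact.image_of_continuousOn (hu.mono hψO)
  have hQV : Q ⊆ V := by
    rintro _ ⟨y, hy, rfl⟩
    exact huV (hψO hy)
  obtain ⟨δ, hδ, hδV⟩ := hQc.exists_cthickening_subset_open hV hQV
  -- The cutoff equals one in a neighbourhood of `Q`, not merely on `Q`, so that `χ T` and `T` have
  -- the same exterior derivative at every point `u y` with `y` in the support of `ψ`.
  obtain ⟨χ, hχ0, hχ1, -⟩ := exists_contMDiffMap_zero_one_nhds_of_isClosed (n := ⊤)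
    (modelWithCornersSelf ℝ (Eucl m))
    (s := (Metric.thickening δ Q)ᶜ) (t := Q) Metric.isOpen_thickening.isClosed_compl hQc.isClosed
    (by
      rw [disjoint_compl_left_iff_subset]
      exact Metric.self_subset_thickening hδ Q)
  have hχs : ContDiff ℝ ∞ χ := χ.contMDiff.contDiff
  have hχt : tsupport χ ⊆ Metric.cthickening δ Q := by
    refine closure_minimal (fun y hy ↦ by_contra fun h ↦ hy ?_) Metric.isClosed_cthickening
    refine hχ0.self_of_nhdsSet y fun h' ↦ h (Metric.thickening_subset_cthickening δ Q h')
  set T' : Eucl m → Eucl m [⋀^Fin k]→L[ℝ] ℝ := fun z ↦ χ z • T z with hT'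
  have hT't : tsupport T' ⊆ tsupport χ := tsupport_smul_subset_left χ T
  have hT's : ContDiff ℝ ∞ T' := by
    refine contDiff_iff_contDiffAt.2 fun z ↦ ?_
    by_cases hz : z ∈ tsupport T'
    · exact hχs.contDiffAt.smul (hT.contDiffAt (hV.mem_nhds (hδV (hχt (hT't hz)))))
    · exact contDiffAt_const.congr_of_eventuallyEq (notMem_tsupport_iff_eventuallyEq.1 hz)
  have hT'c : HasCompactSupport T' :=
    hQc.cthickening.of_isClosed_subset (isClosed_tsupport _) (hT't.trans hχt)
  have heq : ∀ y ∈ tsupport ψ, T' =ᶠ[𝓝 (u y)] T := by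
    intro y hy
    have h1 : ∀ᶠ z in 𝓝 (u y), χ z = 1 :=
      hχ1.filter_mono (nhds_le_nhdsSet (mem_image_of_mem u hy))
    filter_upwards [h1] with z hz
    simp [hT', hz]
  have key := integral_mul_extDeriv_of_hasCompactSupport hO hu hw hG hT's hT'c hψ hψc hψO hw1
  have e1 : ∀ y, ψ y * extDeriv T (u y) (fun i ↦ G y (w i)) =
      ψ y * extDeriv T' (u y) (fun i ↦ G y (w i)) := by
    intro y
    by_cases hy : y ∈ tsupport ψ
    · rw [(heq y hy).extDeriv_eq]
    · simp [image_eq_zero_of_notMem_tsupport hy]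
  have e2 : ∀ y, oneWedge (fderiv ℝ ψ y) ((T (u y)).compContinuousLinearMap (G y)) w =
      oneWedge (fderiv ℝ ψ y) ((T' (u y)).compContinuousLinearMap (G y)) w := by
    intro y
    by_cases hy : y ∈ tsupport ψ
    · rw [(heq y hy).eq_of_nhds]
    · have h0 : fderiv ℝ ψ y = 0 :=
        image_eq_zero_of_notMem_tsupport fun h ↦ hy (tsupport_fderiv_subset ℝ h)
      simp [oneWedge_apply, h0]
  simp only [e1, e2]
  exact key

end LocalStokes

/-! ### Forms in different charts -/

section Charts

variable {n : ℕ} {M : Type*} [TopologicalSpace M] [ChartedSpace (Eucl n) M]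

/-- The coordinate frame of `ℝⁿ`. -/
def stdFrame (n : ℕ) (i : Fin n) : Eucl n := EuclideanSpace.single i (1 : ℝ)

lemma norm_stdFrame_le (i : Fin n) : ‖stdFrame n i‖ ≤ 1 := by
  simp [stdFrame]

/-- The chart `e` is positively oriented with respect to `o`. -/
def IsPositiveChart (o : ∀ x : M, Orientation ℝ (TangentSpace (𝓡 n) x) (Fin n))
    (e : OpenPartialHomeomorph M (Eucl n)) : Prop :=
  ∀ x ∈ e.source, ∃ b : Module.Basis (Fin n) ℝ (TangentSpace (𝓡 n) x), b.orientation = o x ∧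
    ∀ i, b i = mfderiv (𝓡 n) (𝓡 n) e.symm (e x) (stdFrame n i)

lemma IsPositiveChart.restr {o : ∀ x : M, Orientation ℝ (TangentSpace (𝓡 n) x) (Fin n)}
    {e : OpenPartialHomeomorph M (Eucl n)} (h : IsPositiveChart o e) {s : Set M} (hs : IsOpen s) :
    IsPositiveChart o (e.restr s) := by
  intro x hx
  rw [e.restr_source' s hs] at hx
  exact h x hx.1

lemma mdifferentiableAt_of_mem_maximalAtlas {e : OpenPartialHomeomorph M (Eucl n)}
    (he : e ∈ IsManifold.maximalAtlas (𝓡 n) ∞ M) {x : M} (hx : x ∈ e.source) :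
    MDifferentiableAt (𝓡 n) (𝓡 n) e x :=
  (contMDiffAt_of_mem_maximalAtlas he hx).mdifferentiableAt (by simp)

lemma mdifferentiableAt_symm_of_mem_maximalAtlas {e : OpenPartialHomeomorph M (Eucl n)}
    (he : e ∈ IsManifold.maximalAtlas (𝓡 n) ∞ M) {y : Eucl n} (hy : y ∈ e.target) :
    MDifferentiableAt (𝓡 n) (𝓡 n) e.symm y :=
  (contMDiffAt_symm_of_mem_maximalAtlas he hy).mdifferentiableAt (by simp)

/-- The differential of `e⁻¹` as a linear map between model spaces. -/
def symmDeriv (e : OpenPartialHomeomorph M (Eucl n)) (y : Eucl n) : Eucl n →L[ℝ] Eucl n :=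
  mfderiv (𝓡 n) (𝓡 n) e.symm y

lemma formInChart_apply {k : ℕ} (e : OpenPartialHomeomorph M (Eucl n)) (β : DForm n M k)
    (y : Eucl n) (v : Fin k → Eucl n) :
    formInChart e β y v =
      (β (e.symm y) : Eucl n [⋀^Fin k]→L[ℝ] ℝ) (fun i ↦ symmDeriv e y (v i)) :=
  rfl

lemma differentiableAt_transition {e e' : OpenPartialHomeomorph M (Eucl n)}
    (he : e ∈ IsManifold.maximalAtlas (𝓡 n) ∞ M) (he' : e' ∈ IsManifold.maximalAtlas (𝓡 n) ∞ M)
    {y : Eucl n} (hy : y ∈ e.target) (hy' : e.symm y ∈ e'.source) :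
    DifferentiableAt ℝ (e' ∘ e.symm) y :=
  ((mdifferentiableAt_of_mem_maximalAtlas he' hy').comp y
    (mdifferentiableAt_symm_of_mem_maximalAtlas he hy)).differentiableAt

lemma symmDeriv_eq {e e' : OpenPartialHomeomorph M (Eucl n)}
    (he : e ∈ IsManifold.maximalAtlas (𝓡 n) ∞ M) (he' : e' ∈ IsManifold.maximalAtlas (𝓡 n) ∞ M)
    {y : Eucl n} (hy : y ∈ e.target) (hy' : e.symm y ∈ e'.source) :
    symmDeriv e y = (symmDeriv e' (e' (e.symm y))).comp (fderiv ℝ (e' ∘ e.symm) y) := by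
  have hev : e'.symm ∘ (e' ∘ e.symm) =ᶠ[𝓝 y] e.symm := by
    filter_upwards [(e.symm.continuousAt hy).preimage_mem_nhds (e'.open_source.mem_nhds hy')]
      with z hz
    exact e'.left_inv hz
  have h1 := hev.mfderiv_eq (I := 𝓡 n) (I' := 𝓡 n)
  have h2 := mfderiv_comp (I := 𝓡 n) (I' := 𝓡 n) (I'' := 𝓡 n) y
    (g := e'.symm) (f := e' ∘ e.symm)
    (mdifferentiableAt_symm_of_mem_maximalAtlas he' (e'.map_source hy'))
    (differentiableAt_transition he he' hy hy').mdifferentiableAt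
  rw [mfderiv_eq_fderiv] at h2
  exact h1.symm.trans h2

lemma formInChart_change {k : ℕ} {e e' : OpenPartialHomeomorph M (Eucl n)}
    (he : e ∈ IsManifold.maximalAtlas (𝓡 n) ∞ M) (he' : e' ∈ IsManifold.maximalAtlas (𝓡 n) ∞ M)
    (β : DForm n M k) {y : Eucl n} (hy : y ∈ e.target) (hy' : e.symm y ∈ e'.source) :
    formInChart e β y = (formInChart e' β (e' (e.symm y))).compContinuousLinearMap
      (fderiv ℝ (e' ∘ e.symm) y) := by
  ext v
  -- The fibre of `β` depends on the base point, so equal base points are exchanged after viewing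
  -- both values as forms on the model space.
  have h : ∀ x : M, x = e.symm y →
      (β (e.symm y) : Eucl n [⋀^Fin k]→L[ℝ] ℝ) = (β x : Eucl n [⋀^Fin k]→L[ℝ] ℝ) := by
    rintro x rfl; rfl
  rw [formInChart_apply, ContinuousAlternatingMap.compContinuousLinearMap_apply, formInChart_apply,
    h _ (e'.left_inv hy'), symmDeriv_eq he he' hy hy']
  rfl

lemma alternating_map_comp_frame (η : Eucl n [⋀^Fin n]→ₗ[ℝ] ℝ) (L : Eucl n →L[ℝ] Eucl n) :
    η (fun i ↦ L (stdFrame n i)) = L.det * η (stdFrame n) := by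
  set b := (EuclideanSpace.basisFun (Fin n) ℝ).toBasis with hb
  have hbs : (b : Fin n → Eucl n) = stdFrame n := by
    ext1 i; simp [hb, stdFrame]
  rw [η.eq_smul_basis_det b, ← hbs]
  have h := b.det_comp (L : Eucl n →ₗ[ℝ] Eucl n) b
  simp only [AlternatingMap.smul_apply, smul_eq_mul, b.det_self, mul_one] at h ⊢
  rw [mul_comm]
  exact congrArg (· * η b) h

/-- Both coordinate frames represent the orientation at `e.symm y`, so their change of basis
determinant is positive, and by the chain rule it is the Jacobian of the transition map. -/
lemma IsPositiveChart.det_pos {o : ∀ x : M, Orientation ℝ (TangentSpace (𝓡 n) x) (Fin n)}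
    {e e' : OpenPartialHomeomorph M (Eucl n)}
    (he : e ∈ IsManifold.maximalAtlas (𝓡 n) ∞ M) (he' : e' ∈ IsManifold.maximalAtlas (𝓡 n) ∞ M)
    (hpe : IsPositiveChart o e) (hpe' : IsPositiveChart o e')
    {y : Eucl n} (hy : y ∈ e.target) (hy' : e.symm y ∈ e'.source) :
    0 < (fderiv ℝ (e' ∘ e.symm) y).det := by
  obtain ⟨b, hbo, hb⟩ := hpe _ (e.map_target hy)
  obtain ⟨b', hbo', hb'⟩ := hpe' _ hy'
  have h1 : 0 < b'.det b := (b'.orientation_eq_iff_det_pos b).1 (hbo'.trans hbo.symm)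
  have hb1 : ∀ i, (b i : Eucl n) =
      symmDeriv e' (e' (e.symm y)) (fderiv ℝ (e' ∘ e.symm) y (stdFrame n i)) := by
    intro i
    have h2 := hb i
    rw [e.right_inv hy] at h2
    refine h2.trans ?_
    exact congrArg (fun L : Eucl n →L[ℝ] Eucl n ↦ L (stdFrame n i)) (symmDeriv_eq he he' hy hy')
  set B : Module.Basis (Fin n) ℝ (Eucl n) := b' with hB
  have h3 := alternating_map_comp_frame
    (B.det.compLinearMap (symmDeriv e' (e' (e.symm y)) : Eucl n →ₗ[ℝ] Eucl n))
    (fderiv ℝ (e' ∘ e.symm) y)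
  have h4 : (B.det.compLinearMap (symmDeriv e' (e' (e.symm y)) : Eucl n →ₗ[ℝ] Eucl n))
      (stdFrame n) = 1 := by
    rw [AlternatingMap.compLinearMap_apply, ← B.det_self]
    congr 1
    exact funext fun i ↦ (hb' i).symm
  rw [h4, mul_one] at h3
  rw [← h3, AlternatingMap.compLinearMap_apply]
  refine h1.trans_eq ?_
  exact congrArg B.det (funext hb1)

/-- The integral of a top degree form, supported in the domains of two positive charts, is the same
in both charts. -/
lemma integral_formInChart_eq {o : ∀ x : M, Orientation ℝ (TangentSpace (𝓡 n) x) (Fin n)}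
    {e e' : OpenPartialHomeomorph M (Eucl n)}
    (he : e ∈ IsManifold.maximalAtlas (𝓡 n) ∞ M) (he' : e' ∈ IsManifold.maximalAtlas (𝓡 n) ∞ M)
    (hpe : IsPositiveChart o e) (hpe' : IsPositiveChart o e') (β : DForm n M n)
    (hβ : ∀ x ∉ e.source ∩ e'.source, β x = 0) :
    (IntegrableOn (fun y ↦ formInChart e' β y (stdFrame n)) e'.target →
      IntegrableOn (fun y ↦ formInChart e β y (stdFrame n)) e.target) ∧
    ∫ y in e.target, formInChart e β y (stdFrame n) =
      ∫ y in e'.target, formInChart e' β y (stdFrame n) := by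
  set A := e.target ∩ e.symm ⁻¹' e'.source with hA
  set A' := e'.target ∩ e'.symm ⁻¹' e.source with hA'
  have hAo : IsOpen A := e.isOpen_inter_preimage_symm e'.open_source
  have hAo' : IsOpen A' := e'.isOpen_inter_preimage_symm e.open_source
  set Φ := e' ∘ e.symm with hΦ
  have himg : Φ '' A = A' := by
    ext z
    constructor
    · rintro ⟨y, ⟨hy, hy'⟩, rfl⟩
      refine ⟨e'.map_source hy', ?_⟩
      change e'.symm (e' (e.symm y)) ∈ e.source
      rw [e'.left_inv hy']
      exact e.map_target hy
    · rintro ⟨hz, hz'⟩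
      have hz'' : e'.symm z ∈ e.source := hz'
      refine ⟨e (e'.symm z), ⟨e.map_source hz'', ?_⟩, ?_⟩
      · change e.symm (e (e'.symm z)) ∈ e'.source
        rw [e.left_inv hz'']
        exact e'.map_target hz
      · change e' (e.symm (e (e'.symm z))) = z
        rw [e.left_inv hz'', e'.right_inv hz]
  have hinj : InjOn Φ A := by
    intro y hy z hz hyz
    have h1 := e'.injOn hy.2 hz.2 hyz
    exact e.symm.injOn hy.1 hz.1 h1
  have hder : ∀ y ∈ A, HasFDerivWithinAt Φ (fderiv ℝ Φ y) A y := fun y hy ↦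
    (differentiableAt_transition he he' hy.1 hy.2).hasFDerivAt.hasFDerivWithinAt
  have hzero : ∀ y ∈ e.target \ A, formInChart e β y (stdFrame n) = 0 := by
    intro y hy
    have h0 : β (e.symm y) = 0 := hβ _ fun h ↦ hy.2 ⟨hy.1, h.2⟩
    rw [formInChart_apply, h0]
    rfl
  have hzero' : ∀ y ∈ e'.target \ A', formInChart e' β y (stdFrame n) = 0 := by
    intro y hy
    have h0 : β (e'.symm y) = 0 := hβ _ fun h ↦ hy.2 ⟨hy.1, h.1⟩
    rw [formInChart_apply, h0]
    rfl
  -- A top degree coefficient transforms by the Jacobian, whereas the change of variables formula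
  -- uses its absolute value. Positivity of the two charts makes these agree.
  have htrans : EqOn (fun y ↦ |(fderiv ℝ Φ y).det| • formInChart e' β (Φ y) (stdFrame n))
      (fun y ↦ formInChart e β y (stdFrame n)) A := by
    intro y hy
    have h1 := alternating_map_comp_frame (formInChart e' β (Φ y)).toAlternatingMap (fderiv ℝ Φ y)
    have h2 := formInChart_change he he' β hy.1 hy.2
    simp only
    rw [abs_of_pos (hpe.det_pos he he' hpe' hy.1 hy.2), smul_eq_mul, h2]
    exact h1.symm
  constructor
  · intro h
    have h1 : IntegrableOn (fun y ↦ formInChart e' β y (stdFrame n)) (Φ '' A) := by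
      rw [himg]
      exact h.mono_set inter_subset_left
    rw [integrableOn_image_iff_integrableOn_abs_det_fderiv_smul volume hAo.measurableSet hder
      hinj] at h1
    exact (h1.congr_fun htrans hAo.measurableSet).of_forall_sdiff_eq_zero
      e.open_target.measurableSet hzero
  · rw [setIntegral_eq_of_subset_of_forall_sdiff_eq_zero e.open_target.measurableSet
      inter_subset_left hzero,
      setIntegral_eq_of_subset_of_forall_sdiff_eq_zero e'.open_target.measurableSet
      inter_subset_left hzero', ← hA, ← hA', ← himg,
      integral_image_eq_integral_abs_det_fderiv_smul volume hAo.measurableSet hder hinj]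
    exact (setIntegral_congr_fun hAo.measurableSet htrans).symm

end Charts

/-! ### Pullbacks of forms by Sobolev maps between manifolds -/

section Pullback

variable {m k : ℕ} {M N : Type*} [TopologicalSpace M] [ChartedSpace (Eucl (k + 1)) M]
  [TopologicalSpace N] [ChartedSpace (Eucl m) N]

/-- The pullback of a form by a map with (weak) differential `DF`. -/
def pullForm {n l : ℕ} {M : Type*} [TopologicalSpace M] [ChartedSpace (Eucl n) M] {F : M → N}
    (DF : ∀ x : M, TangentSpace (𝓡 n) x →L[ℝ] TangentSpace (𝓡 m) (F x)) (α : DForm m N l) :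
    DForm n M l :=
  fun x ↦ (α (F x)).compContinuousLinearMap (DF x)

/-- The form `ρ dφ ∧ σ`. -/
def wedgeForm {n l : ℕ} {M : Type*} [TopologicalSpace M] [ChartedSpace (Eucl n) M]
    (ρ φ : M → ℝ) (σ : DForm n M l) : DForm n M (l + 1) :=
  fun x ↦ ρ x • oneWedge (V := Eucl n) (mfderiv (𝓡 n) 𝓘(ℝ, ℝ) φ x) (σ x)

/-- Near `F (e.symm y)` the map `e'.symm ∘ e'` is the identity, so its differential can be inserted
after `DF`. This is pointwise algebra in `DF` and asks for no differentiability of `F`. -/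
lemma formInChart_pullForm {n l : ℕ} {M : Type*} [TopologicalSpace M] [ChartedSpace (Eucl n) M]
    {F : M → N} (DF : ∀ x : M, TangentSpace (𝓡 n) x →L[ℝ] TangentSpace (𝓡 m) (F x))
    (α : DForm m N l) (e : OpenPartialHomeomorph M (Eucl n))
    {e' : OpenPartialHomeomorph N (Eucl m)} (he' : e' ∈ IsManifold.maximalAtlas (𝓡 m) ∞ N)
    {y : Eucl n} (hy : F (e.symm y) ∈ e'.source) :
    formInChart e (pullForm DF α) y =
      (formInChart e' α (e' (F (e.symm y)))).compContinuousLinearMap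
        (differentialInCharts DF e e' y) := by
  ext v
  set p := F (e.symm y) with hp
  have hev : e'.symm ∘ e' =ᶠ[𝓝 p] id := by
    filter_upwards [e'.open_source.mem_nhds hy] with z hz
    exact e'.left_inv hz
  have h1 := hev.mfderiv_eq (I := 𝓡 m) (I' := 𝓡 m)
  rw [mfderiv_comp (I := 𝓡 m) (I' := 𝓡 m) (I'' := 𝓡 m) p
    (mdifferentiableAt_symm_of_mem_maximalAtlas he' (e'.map_source hy))
    (mdifferentiableAt_of_mem_maximalAtlas he' hy), mfderiv_id] at h1
  have h2 : ∀ w : Eucl m, symmDeriv e' (e' p)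
      ((mfderiv (𝓡 m) (𝓡 m) e' p : Eucl m →L[ℝ] Eucl m) w) = w := fun w ↦
    congrArg (fun L : Eucl m →L[ℝ] Eucl m ↦ L w) h1
  have h : ∀ q : N, q = p →
      (α q : Eucl m [⋀^Fin l]→L[ℝ] ℝ) = (α p : Eucl m [⋀^Fin l]→L[ℝ] ℝ) := by
    rintro q rfl; rfl
  rw [ContinuousAlternatingMap.compContinuousLinearMap_apply, formInChart_apply, formInChart_apply,
    h _ (e'.left_inv hy)]
  exact congrArg (α p : Eucl m [⋀^Fin l]→L[ℝ] ℝ) (funext fun i ↦ (h2 _).symm)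

lemma formInChart_wedgeForm {n l : ℕ} {M : Type*} [TopologicalSpace M] [ChartedSpace (Eucl n) M]
    {e : OpenPartialHomeomorph M (Eucl n)} (he : e ∈ IsManifold.maximalAtlas (𝓡 n) ∞ M)
    (ρ : M → ℝ) {φ : M → ℝ} (hφ : ContMDiff (𝓡 n) 𝓘(ℝ, ℝ) ∞ φ) (σ : DForm n M l) {y : Eucl n}
    (hy : y ∈ e.target) :
    formInChart e (wedgeForm ρ φ σ) y =
      ρ (e.symm y) • oneWedge (fderiv ℝ (φ ∘ e.symm) y) (formInChart e σ y) := by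
  have h1 := mfderiv_comp (I := 𝓡 n) (I' := 𝓡 n) (I'' := 𝓘(ℝ, ℝ)) y
    ((hφ.mdifferentiable (by simp)) (e.symm y)) (mdifferentiableAt_symm_of_mem_maximalAtlas he hy)
  rw [mfderiv_eq_fderiv] at h1
  have h2 : fderiv ℝ (φ ∘ e.symm) y = ContinuousLinearMap.comp
      (mfderiv (𝓡 n) 𝓘(ℝ, ℝ) φ (e.symm y) : Eucl n →L[ℝ] ℝ) (symmDeriv e y) := h1
  have h3 : formInChart e σ y = ContinuousAlternatingMap.compContinuousLinearMap
      (σ (e.symm y) : Eucl n [⋀^Fin l]→L[ℝ] ℝ) (symmDeriv e y) := rfl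
  rw [h2, h3]
  exact congrArg (ρ (e.symm y) • ·) (oneWedge_comp (V := Eucl n) (W := Eucl n)
    (mfderiv (𝓡 n) 𝓘(ℝ, ℝ) φ (e.symm y)) (σ (e.symm y)) (symmDeriv e y)).symm

lemma contDiffOn_comp_symm {n : ℕ} {M : Type*} [TopologicalSpace M] [ChartedSpace (Eucl n) M]
    {e : OpenPartialHomeomorph M (Eucl n)} (he : e ∈ IsManifold.maximalAtlas (𝓡 n) ∞ M)
    {φ : M → ℝ} (hφ : ContMDiff (𝓡 n) 𝓘(ℝ, ℝ) ∞ φ) :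
    ContDiffOn ℝ ∞ (φ ∘ e.symm) e.target :=
  contMDiffOn_iff_contDiffOn.1 (hφ.comp_contMDiffOn (contMDiffOn_symm_of_mem_maximalAtlas he))

/-- A function supported in the domain of a chart, in coordinates and extended by zero. -/
lemma exists_contDiff_extension {n : ℕ} {M : Type*} [TopologicalSpace M] [CompactSpace M]
    [ChartedSpace (Eucl n) M]
    {e : OpenPartialHomeomorph M (Eucl n)} (he : e ∈ IsManifold.maximalAtlas (𝓡 n) ∞ M)
    {φ : M → ℝ} (hφ : ContMDiff (𝓡 n) 𝓘(ℝ, ℝ) ∞ φ) (hφe : tsupport φ ⊆ e.source) :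
    ∃ ψ : Eucl n → ℝ, ContDiff ℝ ∞ ψ ∧ HasCompactSupport ψ ∧ tsupport ψ ⊆ e.target ∧
      ∀ y ∈ e.target, ψ y = φ (e.symm y) := by
  -- Compactness of `M` makes `Q` compact, hence closed in all of `ℝⁿ`. Extension by zero is then
  -- smooth across the boundary of `e.target`.
  set Q := e '' tsupport φ with hQ
  have hQc : IsCompact Q :=
    (isClosed_tsupport φ).isCompact.image_of_continuousOn (e.continuousOn.mono hφe)
  have hQt : Q ⊆ e.target := by
    rintro _ ⟨x, hx, rfl⟩
    exact e.map_source (hφe hx)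
  have hzero : ∀ y ∉ Q, e.target.indicator (φ ∘ e.symm) y = 0 := by
    intro y hy
    by_cases hyt : y ∈ e.target
    · rw [indicator_of_mem hyt]
      exact image_eq_zero_of_notMem_tsupport (f := φ) fun h ↦ hy ⟨_, h, e.right_inv hyt⟩
    · exact indicator_of_notMem hyt _
  have hts : tsupport (e.target.indicator (φ ∘ e.symm)) ⊆ Q :=
    closure_minimal (fun y hy ↦ by_contra fun h ↦ hy (hzero y h)) hQc.isClosed
  refine ⟨e.target.indicator (φ ∘ e.symm), contDiff_iff_contDiffAt.2 fun y ↦ ?_,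
    hQc.of_isClosed_subset (isClosed_tsupport _) hts, hts.trans hQt,
    fun y hy ↦ indicator_of_mem hy _⟩
  by_cases hy : y ∈ Q
  · have hyt := e.open_target.mem_nhds (hQt hy)
    refine ((contDiffOn_comp_symm he hφ).contDiffAt hyt).congr_of_eventuallyEq ?_
    filter_upwards [hyt] with z hz
    exact indicator_of_mem hz _
  · refine (contDiffAt_const (c := (0 : ℝ))).congr_of_eventuallyEq ?_
    filter_upwards [hQc.isClosed.isOpen_compl.mem_nhds hy] with z hz
    exact hzero z hz

lemma weakDeriv_in_charts {n p : ℕ} {M : Type*} [TopologicalSpace M] [ChartedSpace (Eucl n) M]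
    {F : M → N} {DF : ∀ x : M, TangentSpace (𝓡 n) x →L[ℝ] TangentSpace (𝓡 m) (F x)}
    (hS : IsSobolevWithDifferential p F DF)
    {e : OpenPartialHomeomorph M (Eucl n)} {e' : OpenPartialHomeomorph N (Eucl m)}
    (he : e ∈ IsManifold.maximalAtlas (𝓡 n) ∞ M) (he' : e' ∈ IsManifold.maximalAtlas (𝓡 m) ∞ N)
    (hF : ∀ x ∈ e.source, F x ∈ e'.source) :
    ContinuousOn (fun y ↦ e' (F (e.symm y))) e.target ∧
    IsWeakDerivOn (fun y ↦ e' (F (e.symm y))) (differentialInCharts DF e e') e.target ∧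
    ∀ C : Set (Eucl n), IsCompact C → C ⊆ e.target →
      MemLp (differentialInCharts DF e e') p (volume.restrict C) := by
  have hset : e.target ∩ e.symm ⁻¹' (F ⁻¹' e'.source) = e.target :=
    inter_eq_left.2 fun y hy ↦ hF _ (e.map_target hy)
  have h1 := hS.weakDeriv e he e' he'
  have h2 := hS.memLp_loc e he e' he'
  rw [hset] at h1 h2
  refine ⟨?_, h1, h2⟩
  exact e'.continuousOn.comp (hS.continuous.comp_continuousOn e.continuousOn_symm)
    fun y hy ↦ hF _ (e.map_target hy)

variable {F : M → N}
  {DF : ∀ x : M, TangentSpace (𝓡 (k + 1)) x →L[ℝ] TangentSpace (𝓡 m) (F x)}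

/-- Stokes' theorem in a chart: `∫ φ F^*(dτ) = -∫ dφ ∧ F^*τ`. -/
lemma integral_pullForm_eq [CompactSpace M] (hS : IsSobolevWithDifferential (k + 1) F DF)
    {U : Set N} (hU : IsOpen U) (hFU : ∀ x, F x ∈ U) {τ : DForm m N k} {α : DForm m N (k + 1)}
    (hτ : IsSmoothFormOn U τ) (hd : HasExtDerivOn U τ α)
    {e : OpenPartialHomeomorph M (Eucl (k + 1))} {e' : OpenPartialHomeomorph N (Eucl m)}
    (he : e ∈ IsManifold.maximalAtlas (𝓡 (k + 1)) ∞ M)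
    (he' : e' ∈ IsManifold.maximalAtlas (𝓡 m) ∞ N)
    (hF : ∀ x ∈ e.source, F x ∈ e'.source)
    {φ : M → ℝ} (hφ : ContMDiff (𝓡 (k + 1)) 𝓘(ℝ, ℝ) ∞ φ) (hφe : tsupport φ ⊆ e.source) :
    IntegrableOn (fun y ↦ φ (e.symm y) *
      formInChart e (pullForm DF α) y (stdFrame (k + 1))) e.target ∧
    ∫ y in e.target, φ (e.symm y) * formInChart e (pullForm DF α) y (stdFrame (k + 1)) =
      -∫ y in e.target, formInChart e (wedgeForm 1 φ (pullForm DF τ)) y (stdFrame (k + 1)) := by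
  obtain ⟨ψ, hψ, hψc, hψe, hψφ⟩ := exists_contDiff_extension he hφ hφe
  obtain ⟨hu, hw, hG⟩ := weakDeriv_in_charts hS he he' hF
  set u : Eucl (k + 1) → Eucl m := fun y ↦ e' (F (e.symm y)) with hudef
  set G := differentialInCharts DF e e' with hGdef
  set V := e'.target ∩ e'.symm ⁻¹' U with hV
  have hVo : IsOpen V := e'.isOpen_inter_preimage_symm hU
  have huV : MapsTo u e.target V := by
    intro y hy
    have h1 := hF _ (e.map_target hy)
    refine ⟨e'.map_source h1, ?_⟩
    change e'.symm (e' (F (e.symm y))) ∈ U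
    rw [e'.left_inv h1]
    exact hFU _
  have hT := hτ e' he'
  have key := integral_mul_extDeriv e.open_target hu hw hG hVo huV hT hψ hψc hψe
    (w := stdFrame (k + 1)) norm_stdFrame_le
  have hA : ContinuousOn (fun y ↦ extDeriv (formInChart e' τ) (u y)) e.target := by
    have h1 : ContinuousOn (extDeriv (formInChart e' τ)) V :=
      (ContinuousAlternatingMap.alternatizeUncurryFinCLM ℝ (Eucl m) ℝ).continuous.comp_continuousOn
        (hT.continuousOn_fderiv_of_isOpen hVo (by simp))
    exact h1.comp hu huV
  have hint := integrable_mul_form_apply (p := k + 1) (by simp) hG le_rfl hA hψ.continuous hψc hψe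
    (w := stdFrame (k + 1)) norm_stdFrame_le
  have e1 : EqOn (fun y ↦ ψ y * extDeriv (formInChart e' τ) (u y) fun i ↦ G y (stdFrame (k + 1) i))
      (fun y ↦ φ (e.symm y) * formInChart e (pullForm DF α) y (stdFrame (k + 1))) e.target := by
    intro y hy
    simp only
    rw [formInChart_pullForm DF α e he' (hF _ (e.map_target hy)), hψφ y hy,
      hd e' he' (u y) (huV hy)]
    rfl
  have e2 : EqOn (fun y ↦ oneWedge (fderiv ℝ ψ y)
        ((formInChart e' τ (u y)).compContinuousLinearMap (G y)) (stdFrame (k + 1)))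
      (fun y ↦ formInChart e (wedgeForm 1 φ (pullForm DF τ)) y (stdFrame (k + 1))) e.target := by
    intro y hy
    have h1 : ψ =ᶠ[𝓝 y] φ ∘ e.symm := by
      filter_upwards [e.open_target.mem_nhds hy] with z hz
      exact hψφ z hz
    simp only
    rw [formInChart_wedgeForm he 1 hφ _ hy, formInChart_pullForm DF τ e he' (hF _ (e.map_target hy)),
      h1.fderiv_eq, Pi.one_apply, one_smul]
  refine ⟨hint.integrableOn.congr_fun e1 e.open_target.measurableSet, ?_⟩
  have hψ0 : ∀ y ∉ e.target, ψ y = 0 := fun y hy ↦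
    image_eq_zero_of_notMem_tsupport fun h ↦ hy (hψe h)
  have hdψ0 : ∀ y ∉ e.target, fderiv ℝ ψ y = 0 := fun y hy ↦
    image_eq_zero_of_notMem_tsupport fun h ↦ hy (hψe (tsupport_fderiv_subset ℝ h))
  rw [← setIntegral_congr_fun e.open_target.measurableSet e1,
    ← setIntegral_congr_fun e.open_target.measurableSet e2,
    setIntegral_eq_integral_of_forall_compl_eq_zero fun y hy ↦ by simp [hψ0 y hy],
    setIntegral_eq_integral_of_forall_compl_eq_zero fun y hy ↦ by
      simp [oneWedge_apply, hdψ0 y hy]]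
  exact key

/-- This justifies exchanging sums and integrals in the global argument. Only `ρ` has to be
supported in the chart: the coefficients of `dφ` are continuous on `e.target` and are absorbed into
the degree `k` form. -/
lemma integrableOn_wedgeForm [CompactSpace M] (hS : IsSobolevWithDifferential (k + 1) F DF)
    {U : Set N} (hFU : ∀ x, F x ∈ U) {τ : DForm m N k}
    (hτ : IsSmoothFormOn U τ)
    {e : OpenPartialHomeomorph M (Eucl (k + 1))} {e' : OpenPartialHomeomorph N (Eucl m)}
    (he : e ∈ IsManifold.maximalAtlas (𝓡 (k + 1)) ∞ M)
    (he' : e' ∈ IsManifold.maximalAtlas (𝓡 m) ∞ N)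
    (hF : ∀ x ∈ e.source, F x ∈ e'.source)
    {ρ φ : M → ℝ} (hρ : ContMDiff (𝓡 (k + 1)) 𝓘(ℝ, ℝ) ∞ ρ) (hρe : tsupport ρ ⊆ e.source)
    (hφ : ContMDiff (𝓡 (k + 1)) 𝓘(ℝ, ℝ) ∞ φ) :
    IntegrableOn (fun y ↦
      formInChart e (wedgeForm ρ φ (pullForm DF τ)) y (stdFrame (k + 1))) e.target := by
  obtain ⟨ψ, hψ, hψc, hψe, hψρ⟩ := exists_contDiff_extension he hρ hρe
  obtain ⟨hu, hw, hG⟩ := weakDeriv_in_charts hS he he' hF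
  set u : Eucl (k + 1) → Eucl m := fun y ↦ e' (F (e.symm y)) with hudef
  set G := differentialInCharts DF e e' with hGdef
  set V := e'.target ∩ e'.symm ⁻¹' U with hV
  have huV : MapsTo u e.target V := by
    intro y hy
    have h1 := hF _ (e.map_target hy)
    refine ⟨e'.map_source h1, ?_⟩
    change e'.symm (e' (F (e.symm y))) ∈ U
    rw [e'.left_inv h1]
    exact hFU _
  have hT : ContinuousOn (fun y ↦ formInChart e' τ (u y)) e.target :=
    (hτ e' he').continuousOn.comp hu huV
  have hdφ : ContinuousOn (fderiv ℝ (φ ∘ e.symm)) e.target :=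
    (contDiffOn_comp_symm he hφ).continuousOn_fderiv_of_isOpen e.open_target (by simp)
  have hint : ∀ i : Fin (k + 1), Integrable fun y ↦ ψ y *
      (fderiv ℝ (φ ∘ e.symm) y (stdFrame (k + 1) i) • formInChart e' τ (u y))
        fun l ↦ G y (i.removeNth (stdFrame (k + 1)) l) := fun i ↦
    integrable_mul_form_apply (p := k + 1) (by simp) hG (Nat.le_succ k)
      ((hdφ.clm_apply continuousOn_const).smul hT) hψ.continuous hψc hψe
      fun l ↦ norm_stdFrame_le _
  have hsum := integrable_finsetSum Finset.univ
    fun i _ ↦ (hint i).const_mul ((-1) ^ (i : Fin (k + 1)).val)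
  refine hsum.integrableOn.congr_fun (fun y hy ↦ ?_) e.open_target.measurableSet
  simp only
  rw [formInChart_wedgeForm he ρ hφ _ hy, formInChart_pullForm DF τ e he' (hF _ (e.map_target hy)),
    ← hψρ y hy, ContinuousAlternatingMap.smul_apply, oneWedge_apply, smul_eq_mul, Finset.mul_sum]
  refine Finset.sum_congr rfl fun i _ ↦ ?_
  rw [ContinuousAlternatingMap.smul_apply, smul_eq_mul,
    ContinuousAlternatingMap.compContinuousLinearMap_apply, mul_left_comm]
  rfl

end Pullback

/-! ### The integral of an exact pullback vanishes -/

section Global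

variable {m k : ℕ} {M N : Type*} [TopologicalSpace M] [ChartedSpace (Eucl (k + 1)) M]
  [TopologicalSpace N] [ChartedSpace (Eucl m) N]

lemma formInChart_wedgeForm_eq_mul {n l : ℕ} {M : Type*} [TopologicalSpace M]
    [ChartedSpace (Eucl n) M] (e : OpenPartialHomeomorph M (Eucl n)) (ρ φ : M → ℝ)
    (σ : DForm n M l) (y : Eucl n) (v : Fin (l + 1) → Eucl n) :
    formInChart e (wedgeForm ρ φ σ) y v =
      ρ (e.symm y) * formInChart e (wedgeForm 1 φ σ) y v := by
  have h : ∀ ρ : M → ℝ, formInChart e (wedgeForm ρ φ σ) y v =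
      ρ (e.symm y) * oneWedge (V := Eucl n) (mfderiv (𝓡 n) 𝓘(ℝ, ℝ) φ (e.symm y)) (σ (e.symm y))
        (fun i ↦ symmDeriv e y (v i)) := fun _ ↦ rfl
  rw [h, h 1, Pi.one_apply, one_mul]

lemma oneWedge_zero {V : Type*} [NormedAddCommGroup V] [NormedSpace ℝ V] {l : ℕ}
    (σ : V [⋀^Fin l]→L[ℝ] ℝ) : oneWedge 0 σ = 0 := by
  ext v
  simp [oneWedge_apply]

lemma wedgeForm_eq_zero {n l : ℕ} {M : Type*} [TopologicalSpace M]
    [ChartedSpace (Eucl n) M] (ρ φ : M → ℝ) (σ : DForm n M l) {x : M}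
    (hx : x ∉ tsupport φ ∩ tsupport ρ) : wedgeForm ρ φ σ x = 0 := by
  by_cases h : x ∈ tsupport ρ
  · have h1 : φ =ᶠ[𝓝 x] fun _ ↦ (0 : ℝ) :=
      notMem_tsupport_iff_eventuallyEq.1 fun h' ↦ hx ⟨h', h⟩
    have h2 : (mfderiv (𝓡 n) 𝓘(ℝ, ℝ) φ x : Eucl n →L[ℝ] ℝ) = 0 := by
      have h3 := h1.mfderiv_eq (I := 𝓡 n) (I' := 𝓘(ℝ, ℝ))
      rw [mfderiv_const] at h3
      exact h3
    refine (congrArg (fun η : Eucl n →L[ℝ] ℝ ↦ ρ x • oneWedge (V := Eucl n) η (σ x)) h2).trans ?_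
    exact (congrArg (ρ x • ·) (oneWedge_zero (V := Eucl n) (σ x))).trans (smul_zero _)
  · have h1 : ρ x = 0 := image_eq_zero_of_notMem_tsupport h
    exact (congrArg (· • oneWedge (V := Eucl n) (mfderiv (𝓡 n) 𝓘(ℝ, ℝ) φ x) (σ x)) h1).trans
      (zero_smul _ _)

variable {F : M → N}
  {DF : ∀ x : M, TangentSpace (𝓡 (k + 1)) x →L[ℝ] TangentSpace (𝓡 m) (F x)}

/-- Global Stokes. The local Stokes terms `dφ_i ∧ F^*τ` live in different charts, so they cannot be
added directly. The extra factor `φ_j` localises them to chart `j`, where all `i` can be summed at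
once. -/
lemma sum_integral_pullForm_eq_zero [CompactSpace M]
    (hS : IsSobolevWithDifferential (k + 1) F DF)
    {o : ∀ x : M, Orientation ℝ (TangentSpace (𝓡 (k + 1)) x) (Fin (k + 1))}
    {U : Set N} (hU : IsOpen U) (hFU : ∀ x, F x ∈ U) {τ : DForm m N k} {α : DForm m N (k + 1)}
    (hτ : IsSmoothFormOn U τ) (hd : HasExtDerivOn U τ α) {ι : Type*} [Fintype ι]
    {e : ι → OpenPartialHomeomorph M (Eucl (k + 1))} {e' : ι → OpenPartialHomeomorph N (Eucl m)}
    (he : ∀ i, e i ∈ IsManifold.maximalAtlas (𝓡 (k + 1)) ∞ M)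
    (he' : ∀ i, e' i ∈ IsManifold.maximalAtlas (𝓡 m) ∞ N)
    (hpos : ∀ i, IsPositiveChart o (e i))
    (hF : ∀ i, ∀ x ∈ (e i).source, F x ∈ (e' i).source)
    {φ : ι → M → ℝ} (hφ : ∀ i, ContMDiff (𝓡 (k + 1)) 𝓘(ℝ, ℝ) ∞ (φ i))
    (hφe : ∀ i, tsupport (φ i) ⊆ (e i).source) (hsum : ∀ x, ∑ i, φ i x = 1) :
    ∑ i, ∫ y in (e i).target,
      φ i ((e i).symm y) * formInChart (e i) (pullForm DF α) y (stdFrame (k + 1)) = 0 := by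
  set σ := pullForm DF τ with hσ
  have hint : ∀ i j, IntegrableOn (fun y ↦
      formInChart (e j) (wedgeForm (φ j) (φ i) σ) y (stdFrame (k + 1))) (e j).target := fun i j ↦
    integrableOn_wedgeForm hS hFU hτ (he j) (he' j) (hF j) (hφ j) (hφe j) (hφ i)
  have hchange := fun i j ↦ integral_formInChart_eq (he i) (he j) (hpos i) (hpos j)
    (wedgeForm (φ j) (φ i) σ)
    fun x hx ↦ wedgeForm_eq_zero _ _ _ fun h ↦ hx ⟨hφe i h.1, hφe j h.2⟩
  -- The constant `1 = ∑_j φ_j` is inserted and the `j`-th term is moved from chart `i` to chart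
  -- `j`. Integrability in chart `i` is itself transported from chart `j`, where `φ_j` is compactly
  -- supported.
  have h1 : ∀ i, ∫ y in (e i).target,
      φ i ((e i).symm y) * formInChart (e i) (pullForm DF α) y (stdFrame (k + 1)) =
      -∑ j, ∫ y in (e j).target,
        formInChart (e j) (wedgeForm (φ j) (φ i) σ) y (stdFrame (k + 1)) := by
    intro i
    rw [(integral_pullForm_eq hS hU hFU hτ hd (he i) (he' i) (hF i) (hφ i) (hφe i)).2]
    congr 1
    simp only [← (hchange i _).2]
    rw [← integral_finsetSum _ fun j _ ↦ (hchange i j).1 (hint i j)]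
    refine integral_congr_ae (Eventually.of_forall fun y ↦ ?_)
    simp only [formInChart_wedgeForm_eq_mul _ (φ _) (φ i)]
    rw [← Finset.sum_mul, hsum, one_mul]
  have h2 : ∀ j, ∑ i, ∫ y in (e j).target,
      formInChart (e j) (wedgeForm (φ j) (φ i) σ) y (stdFrame (k + 1)) = 0 := by
    intro j
    rw [← integral_finsetSum _ fun i _ ↦ hint i j]
    refine (setIntegral_congr_fun (g := fun _ ↦ (0 : ℝ)) (e j).open_target.measurableSet
      fun y hy ↦ ?_).trans (by simp)
    have hdiff : ∀ i, DifferentiableAt ℝ (φ i ∘ (e j).symm) y := fun i ↦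
      ((contDiffOn_comp_symm (he j) (hφ i)).contDiffAt
        ((e j).open_target.mem_nhds hy)).differentiableAt (by simp)
    -- The sum of the `φ_i` is constant, so its differential vanishes.
    have hzero : ∑ i, fderiv ℝ (φ i ∘ (e j).symm) y = 0 := by
      rw [← fderiv_sum fun i _ ↦ hdiff i]
      have : (∑ i, φ i ∘ (e j).symm) = fun _ ↦ (1 : ℝ) := by
        ext z
        simpa using hsum ((e j).symm z)
      rw [this]
      simp
    simp only [formInChart_wedgeForm (he j) (φ j) (hφ _) σ hy, ContinuousAlternatingMap.smul_apply,
      oneWedge_apply, smul_eq_mul]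
    rw [← Finset.mul_sum, Finset.sum_comm]
    simp only [← Finset.mul_sum, ← Finset.sum_mul, ← sum_apply, hzero]
    simp
  simp only [h1]
  rw [Finset.sum_neg_distrib, Finset.sum_comm]
  simp only [h2]
  simp

end Global

/-! ### Positivity of the pullback of the calibration -/

section Positivity

/-- The factor `c` is the oriented volume of `b`, positive because `b` is positively oriented. Thus
chart coefficients of top degree forms have the sign of their Hodge star. -/
lemma exists_pos_mul_hodgeStar {n : ℕ} (hn : 0 < n) {V : Type*} [NormedAddCommGroup V]
    [InnerProductSpace ℝ V] [FiniteDimensional ℝ V] [hV : Fact (Module.finrank ℝ V = n)]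
    {o : Orientation ℝ V (Fin n)} (b : Module.Basis (Fin n) ℝ V) (hb : b.orientation = o) :
    ∃ c : ℝ, 0 < c ∧ ∀ η : V [⋀^Fin n]→L[ℝ] ℝ, η b = c * hodgeStar o η := by
  set b' := o.finOrthonormalBasis hn hV.out with hb'
  have ho : b'.toBasis.orientation = o := o.finOrthonormalBasis_orientation hn hV.out
  refine ⟨o.volumeForm b, ?_, fun η ↦ ?_⟩
  · rw [o.volumeForm_robust b' ho]
    exact (b'.toBasis.orientation_eq_iff_det_pos b).1 (ho.trans hb.symm)
  · have h := congrArg (fun f : V [⋀^Fin n]→ₗ[ℝ] ℝ ↦ f b) (eq_hodgeStar_smul_volumeForm o η)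
    simp only [AlternatingMap.smul_apply, smul_eq_mul] at h
    rw [mul_comm]
    exact h

variable {m n : ℕ} {M N : Type*} [TopologicalSpace M] [ChartedSpace (Eucl n) M]
  [TopologicalSpace N] [ChartedSpace (Eucl m) N]
  [RiemannianBundle (fun x : M ↦ TangentSpace (𝓡 n) x)]
  [RiemannianBundle (fun p : N ↦ TangentSpace (𝓡 m) p)]

/-- The left side of the quasiregularity inequality is nonnegative and `K > 0`, so the Hodge star is
nonnegative. If it is zero, the positive comass leaves only `‖DF‖ = 0`. -/
lemma formInChart_pullForm_nonneg (hn : 0 < n)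
    {o : ∀ x : M, Orientation ℝ (TangentSpace (𝓡 n) x) (Fin n)} {F : M → N}
    {DF : ∀ x : M, TangentSpace (𝓡 n) x →L[ℝ] TangentSpace (𝓡 m) (F x)} {α : DForm m N n}
    {K : ℝ} (hK : 1 ≤ K) {e : OpenPartialHomeomorph M (Eucl n)} (hpos : IsPositiveChart o e)
    {y : Eucl n} (hy : y ∈ e.target) (hα : 0 < comass α (F (e.symm y)))
    (hQR : comass α (F (e.symm y)) * ‖DF (e.symm y)‖ ^ n ≤
      K * hodgeStar (o (e.symm y))
        ((α (F (e.symm y))).compContinuousLinearMap (DF (e.symm y)))) :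
    0 ≤ formInChart e (pullForm DF α) y (stdFrame n) ∧
      (formInChart e (pullForm DF α) y (stdFrame n) = 0 → DF (e.symm y) = 0) := by
  obtain ⟨b, hbo, hb⟩ := hpos _ (e.map_target hy)
  rw [e.right_inv hy] at hb
  obtain ⟨c, hc, h⟩ := exists_pos_mul_hodgeStar hn b hbo
  have h1 := h ((α (F (e.symm y))).compContinuousLinearMap (DF (e.symm y)))
  have h2 : formInChart e (pullForm DF α) y (stdFrame n) =
      c * hodgeStar (o (e.symm y))
        ((α (F (e.symm y))).compContinuousLinearMap (DF (e.symm y))) := by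
    rw [← h1]
    exact congrArg (pullForm DF α (e.symm y)) (funext fun i ↦ (hb i).symm)
  have h3 : 0 ≤ comass α (F (e.symm y)) * ‖DF (e.symm y)‖ ^ n := by positivity
  have h4 : 0 ≤ hodgeStar (o (e.symm y))
      ((α (F (e.symm y))).compContinuousLinearMap (DF (e.symm y))) :=
    nonneg_of_mul_nonneg_right (h3.trans hQR) (by linarith)
  refine ⟨h2 ▸ mul_nonneg hc.le h4, fun h0 ↦ ?_⟩
  rw [h2] at h0
  rw [(mul_eq_zero.1 h0).resolve_left hc.ne', mul_zero] at hQR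
  have h5 : ‖DF (e.symm y)‖ ^ n = 0 :=
    le_antisymm (nonpos_of_mul_nonpos_right hQR hα) (by positivity)
  have h6 : ‖DF (e.symm y)‖ = 0 := pow_eq_zero_iff hn.ne' |>.1 h5
  refine ContinuousLinearMap.ext fun v ↦ ?_
  have h7 := (DF (e.symm y)).le_opNorm v
  rw [h6, zero_mul] at h7
  exact norm_le_zero_iff.1 h7

end Positivity

lemma IsWeakDerivOn.mono {n m : ℕ} {u : Eucl n → Eucl m} {G : Eucl n → Eucl n →L[ℝ] Eucl m}
    {O W : Set (Eucl n)} (h : IsWeakDerivOn u G O) (hW : W ⊆ O) : IsWeakDerivOn u G W :=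
  fun φ h1 h2 h3 v ↦ h φ h1 h2 (h3.trans hW) v

/-! ### Quasiregular curves with exact calibration are constant -/

section Constancy

variable {m k : ℕ} {M N : Type*} [TopologicalSpace M] [ChartedSpace (Eucl (k + 1)) M]
  [TopologicalSpace N] [ChartedSpace (Eucl m) N] [IsManifold (𝓡 m) ∞ N]

/-- A positive chart is shrunk by the preimage of a chart domain around `F x`, which is open by
continuity of `F`. The map is then read in a single pair of charts. -/
lemma exists_adapted_charts {o : ∀ x : M, Orientation ℝ (TangentSpace (𝓡 (k + 1)) x) (Fin (k + 1))}
    (ho : IsManifoldOrientation o) {F : M → N} (hF : Continuous F) (x : M) :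
    ∃ e ∈ IsManifold.maximalAtlas (𝓡 (k + 1)) ∞ M, ∃ e' ∈ IsManifold.maximalAtlas (𝓡 m) ∞ N,
      x ∈ e.source ∧ IsPositiveChart o e ∧ ∀ z ∈ e.source, F z ∈ e'.source := by
  obtain ⟨e, he, hx, hpos⟩ := ho x
  set e' := chartAt (Eucl m) (F x) with he'
  have hs : IsOpen (F ⁻¹' e'.source) := e'.open_source.preimage hF
  have hsrc := e.restr_source' _ hs
  refine ⟨e.restr (F ⁻¹' e'.source), restr_mem_maximalAtlas _ he hs, e',
    IsManifold.chart_mem_maximalAtlas _, ?_, IsPositiveChart.restr hpos hs, fun z hz ↦ ?_⟩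
  · rw [hsrc]
    exact ⟨hx, mem_chart_source _ _⟩
  · rw [hsrc] at hz
    exact hz.2

theorem exists_eq_const_of_exact [T2Space M] [CompactSpace M] [ConnectedSpace M]
    [IsManifold (𝓡 (k + 1)) ∞ M] [RiemannianBundle (fun x : M ↦ TangentSpace (𝓡 (k + 1)) x)]
    [RiemannianBundle (fun p : N ↦ TangentSpace (𝓡 m) p)]
    {o : ∀ x : M, Orientation ℝ (TangentSpace (𝓡 (k + 1)) x) (Fin (k + 1))}
    (ho : IsManifoldOrientation o) {α : DForm m N (k + 1)} (hα : ∀ p, 0 < comass α p)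
    {K : ℝ} (hK : 1 ≤ K) {F : M → N} (hF : IsQuasiregularCurve o K α F)
    {U : Set N} (hU : IsOpen U) (hFU : ∀ x, F x ∈ U) {τ : DForm m N k}
    (hτ : IsSmoothFormOn U τ) (hd : HasExtDerivOn U τ α) : ∃ c : N, ∀ x : M, F x = c := by
  obtain ⟨DF, hS, hQR⟩ := hF
  choose e he e' he' hxe hpos hFe using exists_adapted_charts (m := m) (N := N) ho hS.continuous
  obtain ⟨t, ht⟩ := isCompact_univ.elim_finite_subcover (fun x ↦ (e x).source)
    (fun x ↦ (e x).open_source) fun x _ ↦ mem_iUnion.2 ⟨x, hxe x⟩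
  obtain ⟨f, hf⟩ := SmoothPartitionOfUnity.exists_isSubordinate (𝓡 (k + 1)) isClosed_univ
    (fun i : t ↦ (e i).source) (fun i ↦ (e i).open_source) fun x hx ↦ by
      obtain ⟨i, hi, hxi⟩ := mem_iUnion₂.1 (ht hx)
      exact mem_iUnion.2 ⟨⟨i, hi⟩, hxi⟩
  have hsum : ∀ x, ∑ i, f i x = 1 := fun x ↦ by
    rw [← finsum_eq_sum_of_fintype]
    exact f.sum_eq_one (mem_univ x)
  have hsmooth : ∀ i, ContMDiff (𝓡 (k + 1)) 𝓘(ℝ, ℝ) ∞ (f i) := fun i ↦ (f i).contMDiff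
  have hzero := sum_integral_pullForm_eq_zero hS hU hFU hτ hd (fun i : t ↦ he i)
    (fun i ↦ he' i) (fun i ↦ hpos i) (fun i ↦ hFe i) hsmooth hf hsum
  have hae : ∀ i : t, ∀ᵐ y ∂(volume.restrict (e i).target),
      0 ≤ formInChart (e i) (pullForm DF α) y (stdFrame (k + 1)) ∧
      (formInChart (e i) (pullForm DF α) y (stdFrame (k + 1)) = 0 → DF ((e i).symm y) = 0) := by
    intro i
    filter_upwards [hQR (e i) (he i), ae_restrict_mem (e i).open_target.measurableSet] with y h1 h2
    exact formInChart_pullForm_nonneg (Nat.succ_pos k) hK (hpos i) h2 (hα _) h1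
  have hnonneg : ∀ i : t, 0 ≤ᵐ[volume.restrict (e i).target] fun y ↦
      f i ((e i).symm y) * formInChart (e i) (pullForm DF α) y (stdFrame (k + 1)) := fun i ↦ by
    filter_upwards [hae i] with y hy
    exact mul_nonneg (f.nonneg i _) hy.1
  have hDF : ∀ i : t, ∀ᵐ y ∂(volume.restrict (e i).target),
      f i ((e i).symm y) ≠ 0 → DF ((e i).symm y) = 0 := by
    intro i
    -- A vanishing sum of nonnegative integrals has vanishing terms, and an integrable nonnegative
    -- function with zero integral is zero almost everywhere.
    have h1 := (Finset.sum_eq_zero_iff_of_nonneg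
      fun i _ ↦ integral_nonneg_of_ae (hnonneg i)).1 hzero i (Finset.mem_univ i)
    have h2 := (integral_pullForm_eq hS hU hFU hτ hd (he i) (he' i) (hFe i) (hsmooth i) (hf i)).1
    filter_upwards [(integral_eq_zero_iff_of_nonneg_ae (hnonneg i) h2).1 h1, hae i] with y h3 h4 h5
    exact h4.2 ((mul_eq_zero.1 h3).resolve_left h5)
  have hloc : IsLocallyConstant F := by
    refine (IsLocallyConstant.iff_eventually_eq F).2 fun x ↦ ?_
    obtain ⟨i, hi⟩ : ∃ i, f i x ≠ 0 := by
      by_contra! h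
      simpa [h] using hsum x
    have hxi : x ∈ (e i).source := hf i (subset_tsupport _ hi)
    obtain ⟨hu, hw, -⟩ := weakDeriv_in_charts hS (he i) (he' i) (hFe i)
    -- The vanishing of `DF` is only known where the weight `f i` is nonzero. This region is open,
    -- and every point lies in one such region because the weights sum to one.
    set W := (e i).target ∩ (e i).symm ⁻¹' (Function.support (f i)) with hW
    have hWo : IsOpen W :=
      (e i).isOpen_inter_preimage_symm ((f i).contMDiff.continuous.isOpen_support)
    have hG : ∀ᵐ y, y ∈ W → differentialInCharts DF (e i) (e' i) y = 0 := by
      have h1 := (ae_restrict_iff' (e i).open_target.measurableSet).1 (hDF i)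
      filter_upwards [h1] with y h2 hy
      refine ContinuousLinearMap.ext fun v ↦ ?_
      simp only [differentialInCharts, h2 hy.1 hy.2]
      exact map_zero (mfderiv (𝓡 m) (𝓡 m) (e' i) (F ((e i).symm y)))
    have hxW : e i x ∈ W := by
      refine ⟨(e i).map_source hxi, ?_⟩
      change (e i).symm (e i x) ∈ Function.support (f i)
      rw [(e i).left_inv hxi]
      exact hi
    have hev := eventually_eq_of_weakDeriv_eq_zero hWo (hu.mono inter_subset_left)
      (hw.mono inter_subset_left) hG hxW
    filter_upwards [((e i).continuousAt hxi).eventually hev, (e i).open_source.mem_nhds hxi]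
      with z hz hzi
    rw [(e i).left_inv hzi, (e i).left_inv hxi] at hz
    exact (e' i).injOn (hFe i z hzi) (hFe i x hxi) hz
  obtain ⟨x₀⟩ := (inferInstance : Nonempty M)
  exact ⟨F x₀, fun x ↦ hloc.apply_eq_of_preconnectedSpace x x₀⟩

end Constancy

end QRCurve

end

theorem proposition4p1 {n m : ℕ} (hn : 2 ≤ n) (hnm : n ≤ m)
    {M : Type*} [TopologicalSpace M] [T2Space M] [CompactSpace M] [ConnectedSpace M]
    [ChartedSpace (QRCurve.Eucl n) M] [IsManifold (𝓡 n) ∞ M]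
    [RiemannianBundle (fun x : M ↦ TangentSpace (𝓡 n) x)]
    [IsContMDiffRiemannianBundle (𝓡 n) ∞ (QRCurve.Eucl n) (fun x : M ↦ TangentSpace (𝓡 n) x)]
    (o : ∀ x : M, Orientation ℝ (TangentSpace (𝓡 n) x) (Fin n))
    (ho : QRCurve.IsManifoldOrientation o)
    {N : Type*} [TopologicalSpace N] [T2Space N] [SecondCountableTopology N]
    [ChartedSpace (QRCurve.Eucl m) N] [IsManifold (𝓡 m) ∞ N]
    [RiemannianBundle (fun p : N ↦ TangentSpace (𝓡 m) p)]
    [IsContMDiffRiemannianBundle (𝓡 m) ∞ (QRCurve.Eucl m) (fun p : N ↦ TangentSpace (𝓡 m) p)]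
    (α : QRCurve.DForm m N n) (hα : QRCurve.IsNonvanishingCalibration α)
    (K : ℝ) (hK : 1 ≤ K) (F : M → N) (hF : QRCurve.IsQuasiregularCurve o K α F)
    (U : Set N) (hU : IsOpen U) (hFU : range F ⊆ U)
    (hexact : QRCurve.restrictClass hα.smooth hα.closed hU = 0) :
    ∃ c : N, ∀ x : M, F x = c := by
  -- In positive degree, membership in `exactForms` unfolds to a smooth primitive `τ` on `U`.
  obtain ⟨k, rfl⟩ : ∃ k, n = k + 1 := ⟨n - 1, by omega⟩
  have hmem := (Submodule.Quotient.mk_eq_zero _).1 hexact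
  obtain ⟨τ, hτ, hd⟩ := hmem
  exact QRCurve.exists_eq_const_of_exact ho hα.comass_pos hK hF hU
    (fun x ↦ hFU (mem_range_self x)) hτ hd
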